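/- Conventions. Double categories are strict (and small), double functors are strict. A 2-cell is a square with a top and a bottom horizontal 1-cell (1h-cell) and a left and a right vertical 1-cell (1v-cell). Composites of 1-cells are written in diagrammatic order: $f\cdot g$ for "first $f$, then $g$" (1h-cells) and $u\cdot v$ (1v-cells). For 2-cells, $[\alpha\,|\,\beta]$ is the horizontal composite ($\alpha$ on the left) and $\frac{\alpha}{\beta}$ the vertical composite ($\alpha$ on top). $1_A$, $1^A$ are the horizontal and vertical identity 1-cells, $\mathrm{Id}^u$ is the horizontal identity 2-cell on a 1v-cell $u$, and $\mathrm{Id}_f$ the vertical identity 2-cell on a 1h-cell $f$. The double category $[\![\mathbb B,\mathbb C]\!]$. Its objects are the double functors $\mathbb B\to\mathbb C$. Its 1h-cells $x:S\to T$ are the horizontal pseudotransformations: 1h-cells $x_B:SB\to TB$; for every 1v-cell $u:B\to\tilde B$ a 2-cell $x_u$ with top $x_B$, bottom $x_{\tilde B}$, left $Su$, right $Tu$; for every 1h-cell $f:B\to B'$ a vertically invertible 2-cell $x_f$ with top $x_B\cdot Tf$, bottom $Sf\cdot x_{B'}$ and identity vertical sides; such that $x_{1^B}=\mathrm{Id}_{x_B}$,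 $x_{u\cdot u'}=\frac{x_u}{x_{u'}}$, $x_{1_B}=\mathrm{Id}_{x_B}$, $x_{f\cdot f'}=\frac{[x_f|\mathrm{Id}_{Tf'}]}{[\mathrm{Id}_{Sf}|x_{f'}]}$, and $\frac{x_f}{[S\omega|x_v]}=\frac{[x_u|T\omega]}{x_g}$ for every 2-cell $\omega$ with top $f$, bottom $g$, left $u$, right $v$. Its 1v-cells $p:S\to T$ are the vertical pseudotransformations: 1v-cells $p_B:SB\to TB$; for every 1h-cell $f:B\to B'$ a 2-cell $p_f$ with top $Sf$, bottom $Tf$, left $p_B$, right $p_{B'}$; for every 1v-cell $u:B\to\tilde B$ a horizontally invertible 2-cell $p_u$ with left $p_B\cdot Tu$, right $Su\cdot p_{\tilde B}$ and identity horizontal sides; such that $p_{1_B}=\mathrm{Id}^{p_B}$, $p_{f\cdot f'}=[p_f|p_{f'}]$, $p_{1^B}=\mathrm{Id}^{p_B}$, $p_{u\cdot u'}=\big[\tfrac{p_u}{\mathrm{Id}^{Tu'}}\big|\tfrac{\mathrm{Id}^{Su}}{p_{u'}}\big]$, and $\big[p_u\big|\tfrac{S\omega}{p_g}\big]=\big[\tfrac{p_f}{T\omega}\big|p_v\big]$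 for $\omega$ as above. Its 2-cells $\theta$ with top $x$, bottom $y$, left $p$, right $q$ are the modifications: 2-cells $\theta_B$ with top $x_B$, bottom $y_B$, left $p_B$, right $q_B$ such that $\frac{x_f}{[p_f|\theta_{B'}]}=\frac{[\theta_B|q_f]}{y_f}$ for every 1h-cell $f:B\to B'$ and $\big[p_u\big|\tfrac{x_u}{\theta_{\tilde B}}\big]=\big[\tfrac{\theta_B}{y_u}\big|q_u\big]$ for every 1v-cell $u:B\to\tilde B$. Compositions and identities are componentwise in $\mathbb C$, where for $x:S\to T$, $y:T\to R$ one puts $(x\cdot y)_f=\frac{[\mathrm{Id}_{x_B}|y_f]}{[x_f|\mathrm{Id}_{y_{B'}}]}$, and for 1v-cells $p:S\to T$, $q:T\to R$, $(p\cdot q)_u=\big[\tfrac{\mathrm{Id}^{p_B}}{q_u}\big|\tfrac{p_u}{\mathrm{Id}^{q_{\tilde B}}}\big]$. Cubical double functors. A cubical double functor from $\mathbb A$ and $\mathbb B$ to $\mathbb C$ consists of: 1. double functors $(-,A):\mathbb B\to\mathbb C$ for all objects $A\in\mathbb A$ and $(B,-):\mathbb A\to\mathbb C$ for all objects $B\in\mathbb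 B$, with $(-,A)|_B=(B,-)|_A=:(B,A)$ on objects; 2. for all 1h-cells $F:A\to A'$ in $\mathbb A$, $f:B\to B'$ in $\mathbb B$ and 1v-cells $U:A\to\tilde A$ in $\mathbb A$, $u:B\to\tilde B$ in $\mathbb B$, 2-cells of $\mathbb C$: - $(f,F)$, vertically invertible, with top $(B,F)\cdot(f,A')$, bottom $(f,A)\cdot(B',F)$ and identity vertical sides; - $(u,F)$ with top $(B,F)$, bottom $(\tilde B,F)$, left $(u,A)$, right $(u,A')$; - $(f,U)$ with top $(f,A)$, bottom $(f,\tilde A)$, left $(B,U)$, right $(B',U)$; - $(u,U)$, horizontally invertible, with left $(B,U)\cdot(u,\tilde A)$, right $(u,A)\cdot(\tilde B,U)$ and identity horizontal sides; subject to the following axioms. a) Units: $(1_B,F)=\mathrm{Id}_{(B,F)}$, $(f,1_A)=\mathrm{Id}_{(f,A)}$; $(1^B,F)=\mathrm{Id}_{(B,F)}$, $(u,1_A)=\mathrm{Id}^{(u,A)}$; $(1_B,U)=\mathrm{Id}^{(B,U)}$, $(f,1^A)=\mathrm{Id}_{(f,A)}$; $(1^B,U)=\mathrm{Id}^{(B,U)}$,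 $(u,1^A)=\mathrm{Id}^{(u,A)}$. b) Composition, for composable 1-cells $f,f'$; $F,F'$; $u,u'$; $U,U'$ (with $F:A\to A'$, $f:B\to B'$, $U:A\to\tilde A$, $u:B\to\tilde B$): $$(f\cdot f',F)=\frac{[(f,F)|\mathrm{Id}_{(f',A')}]}{[\mathrm{Id}_{(f,A)}|(f',F)]},\qquad (f,F\cdot F')=\frac{[\mathrm{Id}_{(B,F)}|(f,F')]}{[(f,F)|\mathrm{Id}_{(B',F')}]},$$ $$(u\cdot u',F)=\frac{(u,F)}{(u',F)},\quad (u,F\cdot F')=[(u,F)|(u,F')],\quad (f\cdot f',U)=[(f,U)|(f',U)],\quad (f,U\cdot U')=\frac{(f,U)}{(f,U')},$$ $$(u,U\cdot U')=\Big[\frac{\mathrm{Id}^{(B,U)}}{(u,U')}\Big|\frac{(u,U)}{\mathrm{Id}^{(\tilde B,U')}}\Big],\qquad (u\cdot u',U)=\Big[\frac{(u,U)}{\mathrm{Id}^{(u',\tilde A)}}\Big|\frac{\mathrm{Id}^{(u,A)}}{(u',U)}\Big].$$ c) Naturality, for all 2-cells $\omega$ of $\mathbb B$ (top $f:B\to B'$,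 bottom $g$, left $u:B\to\tilde B$, right $v$) and $\zeta$ of $\mathbb A$ (top $F:A\to A'$, bottom $G$, left $U:A\to\tilde A$, right $V$), and for every 1h-cell $F:A\to A'$ and 1v-cell $U:A\to\tilde A$ of $\mathbb A$ in the identities involving $\omega$, and every 1h-cell $f:B\to B'$ and 1v-cell $u:B\to\tilde B$ of $\mathbb B$ in those involving $\zeta$: $$\frac{(f,F)}{[(\omega,A)|(v,F)]}=\frac{[(u,F)|(\omega,A')]}{(g,F)},\qquad \frac{(f,F)}{[(f,U)|(B',\zeta)]}=\frac{[(B,\zeta)|(f,V)]}{(f,G)},$$ $$\Big[(u,U)\Big|\frac{(\omega,A)}{(g,U)}\Big]=\Big[\frac{(f,U)}{(\omega,\tilde A)}\Big|(v,U)\Big],\qquad \Big[(u,U)\Big|\frac{(u,F)}{(\tilde B,\zeta)}\Big]=\Big[\frac{(B,\zeta)}{(u,G)}\Big|(u,V)\Big].$$ Proposition. Let $\mathbb A,\mathbb B,\mathbb C$ be double categories. Sending a double functor $\Phi:\mathbb A\to[\![\mathbb B,\mathbb C]\!]$ to the data $$(-,A)=\Phi(A),\quad (B,A)=\Phi(A)(B),\quad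 (B,F)=\Phi(F)_B,\quad (B,U)=\Phi(U)_B,\quad (B,\zeta)=\Phi(\zeta)_B,$$ $$(f,F)=\Phi(F)_f,\quad (u,F)=\Phi(F)_u,\quad (f,U)=\Phi(U)_f,\quad (u,U)=\Phi(U)_u$$ is a bijection from the set of double functors $\mathbb A\to[\![\mathbb B,\mathbb C]\!]$ to the set of cubical double functors from $\mathbb A$ and $\mathbb B$ to $\mathbb C$. -/

import Mathlib

universe u v w

/-- A strict double category, presented by its objects, horizontal 1-cells, vertical 1-cells and
squares. Composites are written in diagrammatic order (`hcomp f g` is "first `f`, then `g`", and in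
`sqVcomp α β` the square `α` is on top); they are defined exactly for composable pairs, the
composability proof being found automatically. -/
structure DoubleCat where
  Obj : Type u
  Hor : Type u
  Ver : Type u
  Sq : Type u
  hsrc : Hor → Obj
  htgt : Hor → Obj
  vsrc : Ver → Obj
  vtgt : Ver → Obj
  top : Sq → Hor
  bot : Sq → Hor
  left : Sq → Ver
  right : Sq → Ver
  hsrc_top : ∀ α, hsrc (top α) = vsrc (left α)
  htgt_top : ∀ α, htgt (top α) = vsrc (right α)
  hsrc_bot : ∀ α, hsrc (bot α) = vtgt (left α)
  htgt_bot : ∀ α, htgt (bot α) = vtgt (right α)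
  /-- horizontal identity `1_A` -/
  hid : Obj → Hor
  hsrc_hid : ∀ a, hsrc (hid a) = a
  htgt_hid : ∀ a, htgt (hid a) = a
  hcomp : ∀ (f g : Hor) (_ : htgt f = hsrc g := by grind), Hor
  hsrc_hcomp : ∀ f g (h : htgt f = hsrc g), hsrc (hcomp f g) = hsrc f
  htgt_hcomp : ∀ f g (h : htgt f = hsrc g), htgt (hcomp f g) = htgt g
  hid_hcomp : ∀ f, hcomp (hid (hsrc f)) f = f
  hcomp_hid : ∀ f, hcomp f (hid (htgt f)) = f
  hcomp_assoc : ∀ f g k (_ : htgt f = hsrc g) (_ : htgt g = hsrc k),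
    hcomp (hcomp f g) k = hcomp f (hcomp g k)
  /-- vertical identity `1^A` -/
  vid : Obj → Ver
  vsrc_vid : ∀ a, vsrc (vid a) = a
  vtgt_vid : ∀ a, vtgt (vid a) = a
  vcomp : ∀ (s t : Ver) (_ : vtgt s = vsrc t := by grind), Ver
  vsrc_vcomp : ∀ s t (h : vtgt s = vsrc t), vsrc (vcomp s t) = vsrc s
  vtgt_vcomp : ∀ s t (h : vtgt s = vsrc t), vtgt (vcomp s t) = vtgt t
  vid_vcomp : ∀ s, vcomp (vid (vsrc s)) s = s
  vcomp_vid : ∀ s, vcomp s (vid (vtgt s)) = s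
  vcomp_assoc : ∀ s t r (_ : vtgt s = vsrc t) (_ : vtgt t = vsrc r),
    vcomp (vcomp s t) r = vcomp s (vcomp t r)
  /-- horizontal identity square `Id^s` of a vertical 1-cell `s` -/
  sqHid : Ver → Sq
  top_sqHid : ∀ s, top (sqHid s) = hid (vsrc s)
  bot_sqHid : ∀ s, bot (sqHid s) = hid (vtgt s)
  left_sqHid : ∀ s, left (sqHid s) = s
  right_sqHid : ∀ s, right (sqHid s) = s
  sqHcomp : ∀ (α β : Sq) (_ : right α = left β := by grind), Sq
  top_sqHcomp : ∀ α β (h : right α = left β), top (sqHcomp α β) = hcomp (top α) (top β)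
  bot_sqHcomp : ∀ α β (h : right α = left β), bot (sqHcomp α β) = hcomp (bot α) (bot β)
  left_sqHcomp : ∀ α β (h : right α = left β), left (sqHcomp α β) = left α
  right_sqHcomp : ∀ α β (h : right α = left β), right (sqHcomp α β) = right β
  sqHid_sqHcomp : ∀ α, sqHcomp (sqHid (left α)) α = α
  sqHcomp_sqHid : ∀ α, sqHcomp α (sqHid (right α)) = α
  sqHcomp_assoc : ∀ α β γ (_ : right α = left β) (_ : right β = left γ),
    sqHcomp (sqHcomp α β) γ = sqHcomp α (sqHcomp β γ)
  /-- vertical identity square `Id_f` of a horizontal 1-cell `f` -/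
  sqVid : Hor → Sq
  left_sqVid : ∀ f, left (sqVid f) = vid (hsrc f)
  right_sqVid : ∀ f, right (sqVid f) = vid (htgt f)
  top_sqVid : ∀ f, top (sqVid f) = f
  bot_sqVid : ∀ f, bot (sqVid f) = f
  sqVcomp : ∀ (α β : Sq) (_ : bot α = top β := by grind), Sq
  left_sqVcomp : ∀ α β (h : bot α = top β), left (sqVcomp α β) = vcomp (left α) (left β)
  right_sqVcomp : ∀ α β (h : bot α = top β), right (sqVcomp α β) = vcomp (right α) (right β)
  top_sqVcomp : ∀ α β (h : bot α = top β), top (sqVcomp α β) = top α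
  bot_sqVcomp : ∀ α β (h : bot α = top β), bot (sqVcomp α β) = bot β
  sqVid_sqVcomp : ∀ α, sqVcomp (sqVid (top α)) α = α
  sqVcomp_sqVid : ∀ α, sqVcomp α (sqVid (bot α)) = α
  sqVcomp_assoc : ∀ α β γ (_ : bot α = top β) (_ : bot β = top γ),
    sqVcomp (sqVcomp α β) γ = sqVcomp α (sqVcomp β γ)
  sqHid_vid_eq : ∀ a, sqHid (vid a) = sqVid (hid a)
  sqHid_vcomp : ∀ s t (_ : vtgt s = vsrc t), sqHid (vcomp s t) = sqVcomp (sqHid s) (sqHid t)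
  sqVid_hcomp : ∀ f g (_ : htgt f = hsrc g), sqVid (hcomp f g) = sqHcomp (sqVid f) (sqVid g)
  interchange : ∀ α β γ δ (_ : right α = left β) (_ : right γ = left δ) (_ : bot α = top γ)
    (_ : bot β = top δ),
    sqVcomp (sqHcomp α β) (sqHcomp γ δ) = sqHcomp (sqVcomp α γ) (sqVcomp β δ)

namespace DoubleCat

attribute [simp, grind =] hsrc_top htgt_top hsrc_bot htgt_bot hsrc_hid htgt_hid hsrc_hcomp htgt_hcomp
  hid_hcomp hcomp_hid vsrc_vid vtgt_vid vsrc_vcomp vtgt_vcomp vid_vcomp vcomp_vid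
  top_sqHid bot_sqHid left_sqHid right_sqHid top_sqHcomp bot_sqHcomp left_sqHcomp right_sqHcomp
  sqHid_sqHcomp sqHcomp_sqHid left_sqVid right_sqVid top_sqVid bot_sqVid left_sqVcomp right_sqVcomp
  top_sqVcomp bot_sqVcomp sqVid_sqVcomp sqVcomp_sqVid
attribute [grind =] sqHid_vid_eq hcomp_assoc vcomp_assoc

/-- `α` is invertible for the vertical composition of squares. -/
def VInvertible (D : DoubleCat.{u}) (α : D.Sq) : Prop :=
  ∃ (β : D.Sq) (_ : D.bot α = D.top β) (_ : D.bot β = D.top α),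
    D.sqVcomp α β = D.sqVid (D.top α) ∧ D.sqVcomp β α = D.sqVid (D.bot α)

/-- `α` is invertible for the horizontal composition of squares. -/
def HInvertible (D : DoubleCat.{u}) (α : D.Sq) : Prop :=
  ∃ (β : D.Sq) (_ : D.right α = D.left β) (_ : D.right β = D.left α),
    D.sqHcomp α β = D.sqHid (D.left α) ∧ D.sqHcomp β α = D.sqHid (D.right α)

/-- Exchange of the horizontal and the vertical direction; used only to obtain facts about the
vertical direction from the same facts about the horizontal one. -/
def transpose (D : DoubleCat.{u}) : DoubleCat.{u} where
  Obj := D.Obj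
  Hor := D.Ver
  Ver := D.Hor
  Sq := D.Sq
  hsrc := D.vsrc
  htgt := D.vtgt
  vsrc := D.hsrc
  vtgt := D.htgt
  top := D.left
  bot := D.right
  left := D.top
  right := D.bot
  hsrc_top α := (D.hsrc_top α).symm
  htgt_top α := (D.hsrc_bot α).symm
  hsrc_bot α := (D.htgt_top α).symm
  htgt_bot α := (D.htgt_bot α).symm
  hid := D.vid
  hsrc_hid := D.vsrc_vid
  htgt_hid := D.vtgt_vid
  hcomp s t h := D.vcomp s t h
  hsrc_hcomp := D.vsrc_vcomp
  htgt_hcomp := D.vtgt_vcomp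
  hid_hcomp := D.vid_vcomp
  hcomp_hid := D.vcomp_vid
  hcomp_assoc := D.vcomp_assoc
  vid := D.hid
  vsrc_vid := D.hsrc_hid
  vtgt_vid := D.htgt_hid
  vcomp f g h := D.hcomp f g h
  vsrc_vcomp := D.hsrc_hcomp
  vtgt_vcomp := D.htgt_hcomp
  vid_vcomp := D.hid_hcomp
  vcomp_vid := D.hcomp_hid
  vcomp_assoc := D.hcomp_assoc
  sqHid := D.sqVid
  top_sqHid := D.left_sqVid
  bot_sqHid := D.right_sqVid
  left_sqHid := D.top_sqVid
  right_sqHid := D.bot_sqVid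
  sqHcomp α β h := D.sqVcomp α β h
  top_sqHcomp := D.left_sqVcomp
  bot_sqHcomp := D.right_sqVcomp
  left_sqHcomp := D.top_sqVcomp
  right_sqHcomp := D.bot_sqVcomp
  sqHid_sqHcomp := D.sqVid_sqVcomp
  sqHcomp_sqHid := D.sqVcomp_sqVid
  sqHcomp_assoc := D.sqVcomp_assoc
  sqVid := D.sqHid
  left_sqVid := D.top_sqHid
  right_sqVid := D.bot_sqHid
  top_sqVid := D.left_sqHid
  bot_sqVid := D.right_sqHid
  sqVcomp α β h := D.sqHcomp α β h
  left_sqVcomp := D.top_sqHcomp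
  right_sqVcomp := D.bot_sqHcomp
  top_sqVcomp := D.left_sqHcomp
  bot_sqVcomp := D.right_sqHcomp
  sqVid_sqVcomp := D.sqHid_sqHcomp
  sqVcomp_sqVid := D.sqHcomp_sqHid
  sqVcomp_assoc := D.sqHcomp_assoc
  sqHid_vid_eq a := (D.sqHid_vid_eq a).symm
  sqHid_vcomp := D.sqVid_hcomp
  sqVid_hcomp := D.sqHid_vcomp
  interchange α β γ δ h₁ h₂ h₃ h₄ := (D.interchange α γ β δ h₃ h₄ h₁ h₂).symm

end DoubleCat

/-- A strict double functor. -/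
@[ext]
structure DoubleFunctor (B : DoubleCat.{u}) (C : DoubleCat.{v}) where
  obj : B.Obj → C.Obj
  hor : B.Hor → C.Hor
  ver : B.Ver → C.Ver
  sq : B.Sq → C.Sq
  hsrc_hor : ∀ f, C.hsrc (hor f) = obj (B.hsrc f)
  htgt_hor : ∀ f, C.htgt (hor f) = obj (B.htgt f)
  vsrc_ver : ∀ s, C.vsrc (ver s) = obj (B.vsrc s)
  vtgt_ver : ∀ s, C.vtgt (ver s) = obj (B.vtgt s)
  top_sq : ∀ α, C.top (sq α) = hor (B.top α)
  bot_sq : ∀ α, C.bot (sq α) = hor (B.bot α)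
  left_sq : ∀ α, C.left (sq α) = ver (B.left α)
  right_sq : ∀ α, C.right (sq α) = ver (B.right α)
  hor_hid : ∀ b, hor (B.hid b) = C.hid (obj b)
  hor_hcomp : ∀ f g (_ : B.htgt f = B.hsrc g), hor (B.hcomp f g) = C.hcomp (hor f) (hor g)
  ver_vid : ∀ b, ver (B.vid b) = C.vid (obj b)
  ver_vcomp : ∀ s t (_ : B.vtgt s = B.vsrc t), ver (B.vcomp s t) = C.vcomp (ver s) (ver t)
  sq_sqHid : ∀ s, sq (B.sqHid s) = C.sqHid (ver s)
  sq_sqHcomp : ∀ α β (_ : B.right α = B.left β),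
    sq (B.sqHcomp α β) = C.sqHcomp (sq α) (sq β)
  sq_sqVid : ∀ f, sq (B.sqVid f) = C.sqVid (hor f)
  sq_sqVcomp : ∀ α β (_ : B.bot α = B.top β),
    sq (B.sqVcomp α β) = C.sqVcomp (sq α) (sq β)

namespace DoubleFunctor

attribute [simp, grind =] hsrc_hor htgt_hor vsrc_ver vtgt_ver top_sq bot_sq left_sq right_sq
  hor_hid hor_hcomp ver_vid ver_vcomp
attribute [simp] sq_sqHid sq_sqHcomp sq_sqVid sq_sqVcomp

variable {B : DoubleCat.{u}} {C : DoubleCat.{v}}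

/-- The double functor between the transposed double categories. -/
def transpose (F : DoubleFunctor B C) : DoubleFunctor B.transpose C.transpose where
  obj := F.obj
  hor := F.ver
  ver := F.hor
  sq := F.sq
  hsrc_hor := F.vsrc_ver
  htgt_hor := F.vtgt_ver
  vsrc_ver := F.hsrc_hor
  vtgt_ver := F.htgt_hor
  top_sq := F.left_sq
  bot_sq := F.right_sq
  left_sq := F.top_sq
  right_sq := F.bot_sq
  hor_hid := F.ver_vid
  hor_hcomp := F.ver_vcomp
  ver_vid := F.hor_hid
  ver_vcomp := F.hor_hcomp
  sq_sqHid := F.sq_sqVid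
  sq_sqHcomp := F.sq_sqVcomp
  sq_sqVid := F.sq_sqHid
  sq_sqVcomp := F.sq_sqHcomp

end DoubleFunctor

/-- A horizontal pseudotransformation `src ⟶ tgt` between strict double functors: horizontal 1-cells
`app b`, squares `onVer s` natural with respect to the vertical 1-cells, and vertically invertible
globular squares `onHor f`. -/
@[ext]
structure HorTrans (B : DoubleCat.{u}) (C : DoubleCat.{v}) where
  src : DoubleFunctor B C
  tgt : DoubleFunctor B C
  app : B.Obj → C.Hor
  onVer : B.Ver → C.Sq
  onHor : B.Hor → C.Sq
  hsrc_app : ∀ b, C.hsrc (app b) = src.obj b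
  htgt_app : ∀ b, C.htgt (app b) = tgt.obj b
  top_onVer : ∀ s, C.top (onVer s) = app (B.vsrc s)
  bot_onVer : ∀ s, C.bot (onVer s) = app (B.vtgt s)
  left_onVer : ∀ s, C.left (onVer s) = src.ver s
  right_onVer : ∀ s, C.right (onVer s) = tgt.ver s
  top_onHor : ∀ f, C.top (onHor f) = C.hcomp (app (B.hsrc f)) (tgt.hor f)
  bot_onHor : ∀ f, C.bot (onHor f) = C.hcomp (src.hor f) (app (B.htgt f))
  left_onHor : ∀ f, C.left (onHor f) = C.vid (src.obj (B.hsrc f))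
  right_onHor : ∀ f, C.right (onHor f) = C.vid (tgt.obj (B.htgt f))
  invertible : ∀ f, C.VInvertible (onHor f)
  onVer_vid : ∀ b, onVer (B.vid b) = C.sqVid (app b)
  onVer_vcomp : ∀ s t (_ : B.vtgt s = B.vsrc t),
    onVer (B.vcomp s t) = C.sqVcomp (onVer s) (onVer t)
  onHor_hid : ∀ b, onHor (B.hid b) = C.sqVid (app b)
  onHor_hcomp : ∀ f g (_ : B.htgt f = B.hsrc g),
    onHor (B.hcomp f g) = C.sqVcomp (C.sqHcomp (onHor f) (C.sqVid (tgt.hor g)))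
      (C.sqHcomp (C.sqVid (src.hor f)) (onHor g))
  naturality : ∀ ω : B.Sq,
    C.sqVcomp (onHor (B.top ω)) (C.sqHcomp (src.sq ω) (onVer (B.right ω))) =
      C.sqVcomp (C.sqHcomp (onVer (B.left ω)) (tgt.sq ω)) (onHor (B.bot ω))

/-- A vertical pseudotransformation `src ⟶ tgt` between strict double functors: vertical 1-cells
`app b`, squares `onHor f` natural with respect to the horizontal 1-cells, and horizontally
invertible globular squares `onVer s`. -/
@[ext]
structure VerTrans (B : DoubleCat.{u}) (C : DoubleCat.{v}) where
  src : DoubleFunctor B C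
  tgt : DoubleFunctor B C
  app : B.Obj → C.Ver
  onHor : B.Hor → C.Sq
  onVer : B.Ver → C.Sq
  vsrc_app : ∀ b, C.vsrc (app b) = src.obj b
  vtgt_app : ∀ b, C.vtgt (app b) = tgt.obj b
  left_onHor : ∀ f, C.left (onHor f) = app (B.hsrc f)
  right_onHor : ∀ f, C.right (onHor f) = app (B.htgt f)
  top_onHor : ∀ f, C.top (onHor f) = src.hor f
  bot_onHor : ∀ f, C.bot (onHor f) = tgt.hor f
  left_onVer : ∀ s, C.left (onVer s) = C.vcomp (app (B.vsrc s)) (tgt.ver s)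
  right_onVer : ∀ s, C.right (onVer s) = C.vcomp (src.ver s) (app (B.vtgt s))
  top_onVer : ∀ s, C.top (onVer s) = C.hid (src.obj (B.vsrc s))
  bot_onVer : ∀ s, C.bot (onVer s) = C.hid (tgt.obj (B.vtgt s))
  invertible : ∀ s, C.HInvertible (onVer s)
  onHor_hid : ∀ b, onHor (B.hid b) = C.sqHid (app b)
  onHor_hcomp : ∀ f g (_ : B.htgt f = B.hsrc g),
    onHor (B.hcomp f g) = C.sqHcomp (onHor f) (onHor g)
  onVer_vid : ∀ b, onVer (B.vid b) = C.sqHid (app b)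
  onVer_vcomp : ∀ s t (_ : B.vtgt s = B.vsrc t),
    onVer (B.vcomp s t) = C.sqHcomp (C.sqVcomp (onVer s) (C.sqHid (tgt.ver t)))
      (C.sqVcomp (C.sqHid (src.ver s)) (onVer t))
  naturality : ∀ ω : B.Sq,
    C.sqHcomp (onVer (B.left ω)) (C.sqVcomp (src.sq ω) (onHor (B.bot ω))) =
      C.sqHcomp (C.sqVcomp (onHor (B.top ω)) (tgt.sq ω)) (onVer (B.right ω))

attribute [simp, grind =] HorTrans.hsrc_app HorTrans.htgt_app HorTrans.top_onVer HorTrans.bot_onVer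
  HorTrans.left_onVer HorTrans.right_onVer HorTrans.top_onHor HorTrans.bot_onHor
  HorTrans.left_onHor HorTrans.right_onHor
  VerTrans.vsrc_app VerTrans.vtgt_app VerTrans.left_onHor VerTrans.right_onHor
  VerTrans.top_onHor VerTrans.bot_onHor VerTrans.left_onVer VerTrans.right_onVer
  VerTrans.top_onVer VerTrans.bot_onVer

/-- A modification with boundary consisting of horizontal pseudotransformations `top`, `bot` and
vertical pseudotransformations `left`, `right`: a family of squares compatible with the
pseudonaturality squares along horizontal and along vertical 1-cells. -/
@[ext]
structure Modification (B : DoubleCat.{u}) (C : DoubleCat.{v}) where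
  top : HorTrans B C
  bot : HorTrans B C
  left : VerTrans B C
  right : VerTrans B C
  app : B.Obj → C.Sq
  src_top : top.src = left.src
  tgt_top : top.tgt = right.src
  src_bot : bot.src = left.tgt
  tgt_bot : bot.tgt = right.tgt
  top_app : ∀ b, C.top (app b) = top.app b
  bot_app : ∀ b, C.bot (app b) = bot.app b
  left_app : ∀ b, C.left (app b) = left.app b
  right_app : ∀ b, C.right (app b) = right.app b
  onHor : ∀ f : B.Hor,
    C.sqVcomp (top.onHor f) (C.sqHcomp (left.onHor f) (app (B.htgt f))) =
      C.sqVcomp (C.sqHcomp (app (B.hsrc f)) (right.onHor f)) (bot.onHor f)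
  onVer : ∀ s : B.Ver,
    C.sqHcomp (left.onVer s) (C.sqVcomp (top.onVer s) (app (B.vtgt s))) =
      C.sqHcomp (C.sqVcomp (app (B.vsrc s)) (bot.onVer s)) (right.onVer s)


attribute [simp, grind =] Modification.src_top Modification.tgt_top Modification.src_bot
  Modification.tgt_bot Modification.top_app Modification.bot_app Modification.left_app
  Modification.right_app

namespace DoubleCat

variable (D : DoubleCat.{u})

theorem sqVid_sqHcomp_sqVcomp (f : D.Hor) (α β : D.Sq) (h : D.bot α = D.top β)
    (hα : D.left α = D.vid (D.htgt f)) (hβ : D.left β = D.vid (D.htgt f)) :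
    D.sqHcomp (D.sqVid f) (D.sqVcomp α β) =
      D.sqVcomp (D.sqHcomp (D.sqVid f) α) (D.sqHcomp (D.sqVid f) β) := by
  have := D.interchange (D.sqVid f) α (D.sqVid f) β (by grind) (by grind) (by grind) (by grind)
  grind

theorem sqVcomp_sqHcomp_sqVid (f : D.Hor) (α β : D.Sq) (h : D.bot α = D.top β)
    (hα : D.right α = D.vid (D.hsrc f)) (hβ : D.right β = D.vid (D.hsrc f)) :
    D.sqHcomp (D.sqVcomp α β) (D.sqVid f) =
      D.sqVcomp (D.sqHcomp α (D.sqVid f)) (D.sqHcomp β (D.sqVid f)) := by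
  have := D.interchange α (D.sqVid f) β (D.sqVid f) (by grind) (by grind) (by grind) (by grind)
  grind

theorem exchange (α β : D.Sq) (b : D.Obj) (hα : D.right α = D.vid b) (hβ : D.left β = D.vid b) :
    D.sqVcomp (D.sqHcomp (D.sqVid (D.top α)) β) (D.sqHcomp α (D.sqVid (D.bot β))) =
      D.sqVcomp (D.sqHcomp α (D.sqVid (D.top β))) (D.sqHcomp (D.sqVid (D.bot α)) β) := by
  have h₁ := D.interchange (D.sqVid (D.top α)) β α (D.sqVid (D.bot β)) (by grind) (by grind)
    (by grind) (by grind)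
  have h₂ := D.interchange α (D.sqVid (D.top β)) (D.sqVid (D.bot α)) β (by grind) (by grind)
    (by grind) (by grind)
  grind

theorem sqVcomp_four (α β γ δ : D.Sq) (h₁ : D.bot α = D.top β) (h₂ : D.bot β = D.top γ)
    (h₃ : D.bot γ = D.top δ) :
    D.sqVcomp (D.sqVcomp α β) (D.sqVcomp γ δ) =
      D.sqVcomp α (D.sqVcomp (D.sqVcomp β γ) δ) := by
  have e₁ := D.sqVcomp_assoc α β (D.sqVcomp γ δ) (by grind) (by grind)
  have e₂ := D.sqVcomp_assoc β γ δ (by grind) (by grind)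
  grind

theorem VInvertible.comp {D : DoubleCat.{u}} {α β : D.Sq} (hα : D.VInvertible α)
    (hβ : D.VInvertible β) (h : D.bot α = D.top β) : D.VInvertible (D.sqVcomp α β) := by
  obtain ⟨α', a₁, a₂, a₃, a₄⟩ := hα
  obtain ⟨β', b₁, b₂, b₃, b₄⟩ := hβ
  refine ⟨D.sqVcomp β' α', by grind, by grind, ?_, ?_⟩
  · have h₁ := D.sqVcomp_assoc α β (D.sqVcomp β' α') (by grind) (by grind)
    have h₂ := D.sqVcomp_assoc β β' α' (by grind) (by grind)
    grind
  · have h₁ := D.sqVcomp_assoc β' α' (D.sqVcomp α β) (by grind) (by grind)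
    have h₂ := D.sqVcomp_assoc α' α β (by grind) (by grind)
    grind

theorem VInvertible.whisker_left {D : DoubleCat.{u}} {α : D.Sq} (hα : D.VInvertible α) (f : D.Hor)
    (h : D.left α = D.vid (D.htgt f)) : D.VInvertible (D.sqHcomp (D.sqVid f) α) := by
  obtain ⟨α', a₁, a₂, a₃, a₄⟩ := hα
  have h' : D.left α' = D.vid (D.htgt f) := by
    have := congrArg D.left a₃
    have := D.vid_vcomp (D.left α')
    grind
  refine ⟨D.sqHcomp (D.sqVid f) α', by grind, by grind, ?_, ?_⟩
  · grind [D.sqVid_sqHcomp_sqVcomp, D.sqVid_hcomp]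
  · grind [D.sqVid_sqHcomp_sqVcomp, D.sqVid_hcomp]

theorem VInvertible.whisker_right {D : DoubleCat.{u}} {α : D.Sq} (hα : D.VInvertible α) (f : D.Hor)
    (h : D.right α = D.vid (D.hsrc f)) : D.VInvertible (D.sqHcomp α (D.sqVid f)) := by
  obtain ⟨α', a₁, a₂, a₃, a₄⟩ := hα
  have h' : D.right α' = D.vid (D.hsrc f) := by
    have := congrArg D.right a₃
    have := D.vid_vcomp (D.right α')
    grind
  refine ⟨D.sqHcomp α' (D.sqVid f), by grind, by grind, ?_, ?_⟩
  · grind [D.sqVcomp_sqHcomp_sqVid, D.sqVid_hcomp]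
  · grind [D.sqVcomp_sqHcomp_sqVid, D.sqVid_hcomp]

end DoubleCat

namespace HorTrans

variable {B : DoubleCat.{u}} {C : DoubleCat.{v}}

/-- The identity horizontal pseudotransformation. -/
def id (F : DoubleFunctor B C) : HorTrans B C where
  src := F
  tgt := F
  app b := C.hid (F.obj b)
  onVer s := C.sqHid (F.ver s)
  onHor f := C.sqVid (F.hor f)
  hsrc_app := by grind
  htgt_app := by grind
  top_onVer := by grind
  bot_onVer := by grind
  left_onVer := by grind
  right_onVer := by grind
  top_onHor := by grind
  bot_onHor := by grind
  left_onHor := by grind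
  right_onHor := by grind
  invertible f := ⟨C.sqVid (F.hor f), by grind, by grind, by grind, by grind⟩
  onVer_vid b := by grind
  onVer_vcomp s t h := by grind [C.sqHid_vcomp]
  onHor_hid b := by grind
  onHor_hcomp f g h := by grind [C.sqVid_hcomp]
  naturality ω := by grind

/-- Composition of horizontal pseudotransformations. -/
def comp (x y : HorTrans B C) (h : x.tgt = y.src) : HorTrans B C where
  src := x.src
  tgt := y.tgt
  app b := C.hcomp (x.app b) (y.app b)
  onVer s := C.sqHcomp (x.onVer s) (y.onVer s)
  onHor f := C.sqVcomp (C.sqHcomp (C.sqVid (x.app (B.hsrc f))) (y.onHor f))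
    (C.sqHcomp (x.onHor f) (C.sqVid (y.app (B.htgt f))))
  hsrc_app := by grind
  htgt_app := by grind
  top_onVer := by grind
  bot_onVer := by grind
  left_onVer := by grind
  right_onVer := by grind
  top_onHor := by grind
  bot_onHor := by grind
  left_onHor := by grind
  right_onHor := by grind
  invertible f := ((y.invertible f).whisker_left _ (by grind)).comp
    ((x.invertible f).whisker_right _ (by grind)) (by grind)
  onVer_vid b := by grind [C.sqVid_hcomp, onVer_vid]
  onVer_vcomp s t h := by grind [onVer_vcomp, C.interchange]
  onHor_hid b := by grind [onHor_hid, C.sqVid_hcomp]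
  onHor_hcomp f g h₀ := by
    have hx := x.onHor_hcomp f g h₀
    have hy := y.onHor_hcomp f g h₀
    have e₁ := C.sqVid_sqHcomp_sqVcomp (x.app (B.hsrc f))
      (C.sqHcomp (y.onHor f) (C.sqVid (y.tgt.hor g)))
      (C.sqHcomp (C.sqVid (y.src.hor f)) (y.onHor g)) (by grind) (by grind) (by grind)
    have e₂ := C.sqVcomp_sqHcomp_sqVid (y.app (B.htgt g))
      (C.sqHcomp (x.onHor f) (C.sqVid (x.tgt.hor g)))
      (C.sqHcomp (C.sqVid (x.src.hor f)) (x.onHor g)) (by grind) (by grind) (by grind)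
    have e₃ := C.sqVcomp_sqHcomp_sqVid (y.tgt.hor g)
      (C.sqHcomp (C.sqVid (x.app (B.hsrc f))) (y.onHor f))
      (C.sqHcomp (x.onHor f) (C.sqVid (y.app (B.htgt f)))) (by grind) (by grind) (by grind)
    have e₄ := C.sqVid_sqHcomp_sqVcomp (x.src.hor f)
      (C.sqHcomp (C.sqVid (x.app (B.hsrc g))) (y.onHor g))
      (C.sqHcomp (x.onHor g) (C.sqVid (y.app (B.htgt g)))) (by grind) (by grind) (by grind)
    have e₅ := C.exchange (x.onHor f) (y.onHor g) (y.src.obj (B.hsrc g)) (by grind) (by grind)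
    have e₆ := C.sqHcomp_assoc (C.sqVid (x.app (B.hsrc f))) (C.sqVid (y.src.hor f)) (y.onHor g)
      (by grind) (by grind)
    have e₇ := C.sqHcomp_assoc (x.onHor f) (C.sqVid (x.tgt.hor g)) (C.sqVid (y.app (B.htgt g)))
      (by grind) (by grind)
    have e₈ := C.sqHcomp_assoc (x.onHor f) (C.sqVid (y.app (B.htgt f))) (C.sqVid (y.tgt.hor g))
      (by grind) (by grind)
    have e₉ := C.sqHcomp_assoc (C.sqVid (x.src.hor f)) (C.sqVid (x.app (B.hsrc g))) (y.onHor g)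
      (by grind) (by grind)
    have i₁ := C.sqVid_hcomp (x.app (B.hsrc f)) (y.src.hor f) (by grind)
    have i₂ := C.sqVid_hcomp (x.tgt.hor g) (y.app (B.htgt g)) (by grind)
    have i₃ := C.sqVid_hcomp (y.app (B.htgt f)) (y.tgt.hor g) (by grind)
    have i₄ := C.sqVid_hcomp (x.src.hor f) (x.app (B.hsrc g)) (by grind)
    have a₁ := C.sqHcomp_assoc (C.sqVid (x.app (B.hsrc f))) (y.onHor f) (C.sqVid (y.tgt.hor g))
      (by grind) (by grind)
    have a₂ := C.sqHcomp_assoc (C.sqVid (x.src.hor f)) (x.onHor g) (C.sqVid (y.app (B.htgt g)))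
      (by grind) (by grind)
    have j₁ := C.sqVcomp_four
      (C.sqHcomp (C.sqVid (x.app (B.hsrc f))) (C.sqHcomp (y.onHor f) (C.sqVid (y.tgt.hor g))))
      (C.sqHcomp (C.sqVid (x.app (B.hsrc f))) (C.sqHcomp (C.sqVid (y.src.hor f)) (y.onHor g)))
      (C.sqHcomp (C.sqHcomp (x.onHor f) (C.sqVid (x.tgt.hor g))) (C.sqVid (y.app (B.htgt g))))
      (C.sqHcomp (C.sqHcomp (C.sqVid (x.src.hor f)) (x.onHor g)) (C.sqVid (y.app (B.htgt g))))
      (by grind) (by grind) (by grind)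
    have j₂ := C.sqVcomp_four
      (C.sqHcomp (C.sqHcomp (C.sqVid (x.app (B.hsrc f))) (y.onHor f)) (C.sqVid (y.tgt.hor g)))
      (C.sqHcomp (C.sqHcomp (x.onHor f) (C.sqVid (y.app (B.htgt f)))) (C.sqVid (y.tgt.hor g)))
      (C.sqHcomp (C.sqVid (x.src.hor f)) (C.sqHcomp (C.sqVid (x.app (B.hsrc g))) (y.onHor g)))
      (C.sqHcomp (C.sqVid (x.src.hor f)) (C.sqHcomp (x.onHor g) (C.sqVid (y.app (B.htgt g)))))
      (by grind) (by grind) (by grind)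
    grind
  naturality ω := by
    have hx := x.naturality ω
    have hy := y.naturality ω
    have e₁ := C.sqVcomp_assoc (C.sqHcomp (C.sqVid (x.app (B.hsrc (B.top ω)))) (y.onHor (B.top ω)))
      (C.sqHcomp (x.onHor (B.top ω)) (C.sqVid (y.app (B.htgt (B.top ω)))))
      (C.sqHcomp (x.src.sq ω) (C.sqHcomp (x.onVer (B.right ω)) (y.onVer (B.right ω))))
      (by grind) (by grind)
    have e₂ := C.sqHcomp_assoc (x.src.sq ω) (x.onVer (B.right ω)) (y.onVer (B.right ω))
      (by grind) (by grind)
    have e₃ := C.interchange (x.onHor (B.top ω)) (C.sqVid (y.app (B.htgt (B.top ω))))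
      (C.sqHcomp (x.src.sq ω) (x.onVer (B.right ω))) (y.onVer (B.right ω))
      (by grind) (by grind) (by grind) (by grind)
    have e₄ := C.interchange (C.sqHcomp (x.onVer (B.left ω)) (x.tgt.sq ω)) (y.onVer (B.right ω))
      (x.onHor (B.bot ω)) (C.sqVid (y.app (B.htgt (B.bot ω))))
      (by grind) (by grind) (by grind) (by grind)
    have e₅ := C.sqHcomp_assoc (x.onVer (B.left ω)) (x.tgt.sq ω) (y.onVer (B.right ω))
      (by grind) (by grind)
    have e₆ := C.sqVcomp_assoc (C.sqHcomp (C.sqVid (x.app (B.hsrc (B.top ω)))) (y.onHor (B.top ω)))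
      (C.sqHcomp (x.onVer (B.left ω)) (C.sqHcomp (y.src.sq ω) (y.onVer (B.right ω))))
      (C.sqHcomp (x.onHor (B.bot ω)) (C.sqVid (y.app (B.htgt (B.bot ω)))))
      (by grind) (by grind)
    have e₇ := C.interchange (C.sqVid (x.app (B.hsrc (B.top ω)))) (y.onHor (B.top ω))
      (x.onVer (B.left ω)) (C.sqHcomp (y.src.sq ω) (y.onVer (B.right ω)))
      (by grind) (by grind) (by grind) (by grind)
    have e₈ := C.interchange (x.onVer (B.left ω)) (C.sqHcomp (y.onVer (B.left ω)) (y.tgt.sq ω))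
      (C.sqVid (x.app (B.hsrc (B.bot ω)))) (y.onHor (B.bot ω))
      (by grind) (by grind) (by grind) (by grind)
    have e₉ := C.sqHcomp_assoc (x.onVer (B.left ω)) (y.onVer (B.left ω)) (y.tgt.sq ω)
      (by grind) (by grind)
    have e₁₀ := C.sqVcomp_assoc
      (C.sqHcomp (x.onVer (B.left ω)) (C.sqHcomp (y.onVer (B.left ω)) (y.tgt.sq ω)))
      (C.sqHcomp (C.sqVid (x.app (B.hsrc (B.bot ω)))) (y.onHor (B.bot ω)))
      (C.sqHcomp (x.onHor (B.bot ω)) (C.sqVid (y.app (B.htgt (B.bot ω)))))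
      (by grind) (by grind)
    grind
end HorTrans

namespace HorTrans

variable {B : DoubleCat.{u}} {C : DoubleCat.{v}}

theorem id_comp (x : HorTrans B C) : comp (id x.src) x rfl = x := by
  ext1
  · rfl
  · rfl
  · funext b; simp [comp, id]; grind
  · funext s; simp [comp, id]; grind
  · funext f
    simp only [comp, id]
    have h := C.sqVid_hcomp (x.src.hor f) (x.app (B.htgt f)) (by grind)
    have h₁ := C.sqHid_vid_eq (x.src.obj (B.hsrc f))
    have h₂ := C.sqHid_sqHcomp (x.onHor f)
    grind

theorem comp_id (x : HorTrans B C) : comp x (id x.tgt) rfl = x := by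
  ext1
  · rfl
  · rfl
  · funext b; simp [comp, id]; grind
  · funext s; simp [comp, id]; grind
  · funext f
    simp only [comp, id]
    have h := C.sqVid_hcomp (x.app (B.hsrc f)) (x.tgt.hor f) (by grind)
    have h₁ := C.sqHid_vid_eq (x.tgt.obj (B.htgt f))
    have h₂ := C.sqHcomp_sqHid (x.onHor f)
    grind

theorem comp_assoc (x y z : HorTrans B C) (h : x.tgt = y.src) (h' : y.tgt = z.src) :
    comp (comp x y h) z h' = comp x (comp y z h') h := by
  ext1
  · rfl
  · rfl
  · funext b; simp only [comp]; grind
  · funext s; simp only [comp]; exact C.sqHcomp_assoc _ _ _ (by grind) (by grind)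
  · funext f
    simp only [comp]
    have e₁ := C.sqVid_sqHcomp_sqVcomp (x.app (B.hsrc f))
      (C.sqHcomp (C.sqVid (y.app (B.hsrc f))) (z.onHor f))
      (C.sqHcomp (y.onHor f) (C.sqVid (z.app (B.htgt f)))) (by grind) (by grind) (by grind)
    have e₂ := C.sqVcomp_sqHcomp_sqVid (z.app (B.htgt f))
      (C.sqHcomp (C.sqVid (x.app (B.hsrc f))) (y.onHor f))
      (C.sqHcomp (x.onHor f) (C.sqVid (y.app (B.htgt f)))) (by grind) (by grind) (by grind)
    have i₁ := C.sqVid_hcomp (x.app (B.hsrc f)) (y.app (B.hsrc f)) (by grind)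
    have i₂ := C.sqVid_hcomp (y.app (B.htgt f)) (z.app (B.htgt f)) (by grind)
    have a₁ := C.sqHcomp_assoc (C.sqVid (x.app (B.hsrc f))) (C.sqVid (y.app (B.hsrc f)))
      (z.onHor f) (by grind) (by grind)
    have a₂ := C.sqHcomp_assoc (C.sqVid (x.app (B.hsrc f))) (y.onHor f)
      (C.sqVid (z.app (B.htgt f))) (by grind) (by grind)
    have a₃ := C.sqHcomp_assoc (x.onHor f) (C.sqVid (y.app (B.htgt f)))
      (C.sqVid (z.app (B.htgt f))) (by grind) (by grind)
    have j := C.sqVcomp_assoc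
      (C.sqHcomp (C.sqVid (x.app (B.hsrc f)))
        (C.sqHcomp (C.sqVid (y.app (B.hsrc f))) (z.onHor f)))
      (C.sqHcomp (C.sqVid (x.app (B.hsrc f)))
        (C.sqHcomp (y.onHor f) (C.sqVid (z.app (B.htgt f)))))
      (C.sqHcomp (x.onHor f)
        (C.sqHcomp (C.sqVid (y.app (B.htgt f))) (C.sqVid (z.app (B.htgt f)))))
      (by grind) (by grind)
    grind

/-- A horizontal pseudotransformation as a vertical one between the transposed double functors. -/
def transpose (x : HorTrans B C) : VerTrans B.transpose C.transpose where
  src := x.src.transpose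
  tgt := x.tgt.transpose
  app := x.app
  onHor := x.onVer
  onVer := x.onHor
  vsrc_app := x.hsrc_app
  vtgt_app := x.htgt_app
  left_onHor := x.top_onVer
  right_onHor := x.bot_onVer
  top_onHor := x.left_onVer
  bot_onHor := x.right_onVer
  left_onVer := x.top_onHor
  right_onVer := x.bot_onHor
  top_onVer := x.left_onHor
  bot_onVer := x.right_onHor
  invertible := x.invertible
  onHor_hid := x.onVer_vid
  onHor_hcomp := x.onVer_vcomp
  onVer_vid := x.onHor_hid
  onVer_vcomp := x.onHor_hcomp
  naturality := x.naturality

end HorTrans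

namespace VerTrans

variable {B : DoubleCat.{u}} {C : DoubleCat.{v}}

/-- A vertical pseudotransformation as a horizontal one between the transposed double functors. -/
def transpose (p : VerTrans B C) : HorTrans B.transpose C.transpose where
  src := p.src.transpose
  tgt := p.tgt.transpose
  app := p.app
  onVer := p.onHor
  onHor := p.onVer
  hsrc_app := p.vsrc_app
  htgt_app := p.vtgt_app
  top_onVer := p.left_onHor
  bot_onVer := p.right_onHor
  left_onVer := p.top_onHor
  right_onVer := p.bot_onHor
  top_onHor := p.left_onVer
  bot_onHor := p.right_onVer
  left_onHor := p.top_onVer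
  right_onHor := p.bot_onVer
  invertible := p.invertible
  onVer_vid := p.onHor_hid
  onVer_vcomp := p.onHor_hcomp
  onHor_hid := p.onVer_vid
  onHor_hcomp := p.onVer_vcomp
  naturality := p.naturality

theorem transpose_injective {p q : VerTrans B C} (h : p.transpose = q.transpose) : p = q := by
  have h₁ := congrArg (fun x => x.src.transpose) h
  have h₂ := congrArg (fun x => x.tgt.transpose) h
  exact VerTrans.ext h₁ h₂ (congrArg (fun x => x.app) h) (congrArg (fun x => x.onVer) h)
    (congrArg (fun x => x.onHor) h)

/-- The identity vertical pseudotransformation. -/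
def id (F : DoubleFunctor B C) : VerTrans B C where
  src := F
  tgt := F
  app b := C.vid (F.obj b)
  onHor f := C.sqVid (F.hor f)
  onVer s := C.sqHid (F.ver s)
  vsrc_app := (HorTrans.id F.transpose).hsrc_app
  vtgt_app := (HorTrans.id F.transpose).htgt_app
  left_onHor := (HorTrans.id F.transpose).top_onVer
  right_onHor := (HorTrans.id F.transpose).bot_onVer
  top_onHor := (HorTrans.id F.transpose).left_onVer
  bot_onHor := (HorTrans.id F.transpose).right_onVer
  left_onVer := (HorTrans.id F.transpose).top_onHor
  right_onVer := (HorTrans.id F.transpose).bot_onHor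
  top_onVer := (HorTrans.id F.transpose).left_onHor
  bot_onVer := (HorTrans.id F.transpose).right_onHor
  invertible := (HorTrans.id F.transpose).invertible
  onHor_hid := (HorTrans.id F.transpose).onVer_vid
  onHor_hcomp := (HorTrans.id F.transpose).onVer_vcomp
  onVer_vid := (HorTrans.id F.transpose).onHor_hid
  onVer_vcomp := (HorTrans.id F.transpose).onHor_hcomp
  naturality := (HorTrans.id F.transpose).naturality

/-- The horizontal composite of the transposes; used only for the proofs in `VerTrans.comp`. -/
abbrev compT (p q : VerTrans B C) (h : p.tgt = q.src) : HorTrans B.transpose C.transpose :=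
  p.transpose.comp q.transpose (congrArg DoubleFunctor.transpose h)

/-- Composition of vertical pseudotransformations. -/
def comp (p q : VerTrans B C) (h : p.tgt = q.src) : VerTrans B C where
  src := p.src
  tgt := q.tgt
  app b := C.vcomp (p.app b) (q.app b)
  onHor f := C.sqVcomp (p.onHor f) (q.onHor f)
  onVer s := C.sqHcomp (C.sqVcomp (C.sqHid (p.app (B.vsrc s))) (q.onVer s))
    (C.sqVcomp (p.onVer s) (C.sqHid (q.app (B.vtgt s))))
  vsrc_app := (compT p q h).hsrc_app
  vtgt_app := (compT p q h).htgt_app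
  left_onHor := (compT p q h).top_onVer
  right_onHor := (compT p q h).bot_onVer
  top_onHor := (compT p q h).left_onVer
  bot_onHor := (compT p q h).right_onVer
  left_onVer := (compT p q h).top_onHor
  right_onVer := (compT p q h).bot_onHor
  top_onVer := (compT p q h).left_onHor
  bot_onVer := (compT p q h).right_onHor
  invertible := (compT p q h).invertible
  onHor_hid := (compT p q h).onVer_vid
  onHor_hcomp := (compT p q h).onVer_vcomp
  onVer_vid := (compT p q h).onHor_hid
  onVer_vcomp := (compT p q h).onHor_hcomp
  naturality := (compT p q h).naturality

theorem id_comp (x : VerTrans B C) : comp (id x.src) x rfl = x :=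
  transpose_injective (HorTrans.id_comp x.transpose)

theorem comp_id (x : VerTrans B C) : comp x (id x.tgt) rfl = x :=
  transpose_injective (HorTrans.comp_id x.transpose)

theorem comp_assoc (x y z : VerTrans B C) (h : x.tgt = y.src) (h' : y.tgt = z.src) :
    comp (comp x y h) z h' = comp x (comp y z h') h :=
  transpose_injective (HorTrans.comp_assoc x.transpose y.transpose z.transpose
    (congrArg DoubleFunctor.transpose h) (congrArg DoubleFunctor.transpose h'))

end VerTrans

namespace Modification

variable {B : DoubleCat.{u}} {C : DoubleCat.{v}}

/-- A modification, seen in the transposed double categories. -/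
def transpose (m : Modification B C) : Modification B.transpose C.transpose where
  top := m.left.transpose
  bot := m.right.transpose
  left := m.top.transpose
  right := m.bot.transpose
  app := m.app
  src_top := congrArg DoubleFunctor.transpose m.src_top.symm
  tgt_top := congrArg DoubleFunctor.transpose m.src_bot.symm
  src_bot := congrArg DoubleFunctor.transpose m.tgt_top.symm
  tgt_bot := congrArg DoubleFunctor.transpose m.tgt_bot.symm
  top_app := m.left_app
  bot_app := m.right_app
  left_app := m.top_app
  right_app := m.bot_app
  onHor := m.onVer
  onVer := m.onHor

/-- The horizontal identity modification of a vertical pseudotransformation. -/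
def hid (p : VerTrans B C) : Modification B C where
  top := HorTrans.id p.src
  bot := HorTrans.id p.tgt
  left := p
  right := p
  app b := C.sqHid (p.app b)
  src_top := rfl
  tgt_top := rfl
  src_bot := rfl
  tgt_bot := rfl
  top_app b := by simp [HorTrans.id]
  bot_app b := by simp [HorTrans.id]
  left_app b := by simp
  right_app b := by simp
  onHor f := by
    simp only [HorTrans.id]
    have h₁ := C.sqHcomp_sqHid (p.onHor f)
    have h₂ := C.sqHid_sqHcomp (p.onHor f)
    have h₃ := C.sqVid_sqVcomp (p.onHor f)
    have h₄ := C.sqVcomp_sqVid (p.onHor f)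
    grind
  onVer s := by
    simp only [HorTrans.id]
    have h₁ := C.sqHcomp_sqHid (p.onVer s)
    have h₂ := C.sqHid_sqHcomp (p.onVer s)
    have h₃ := C.sqHid_vcomp (p.src.ver s) (p.app (B.vtgt s)) (by grind)
    have h₄ := C.sqHid_vcomp (p.app (B.vsrc s)) (p.tgt.ver s) (by grind)
    grind

/-- The vertical identity modification of a horizontal pseudotransformation. -/
def vid (x : HorTrans B C) : Modification B C where
  top := x
  bot := x
  left := VerTrans.id x.src
  right := VerTrans.id x.tgt
  app b := C.sqVid (x.app b)
  src_top := rfl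
  tgt_top := rfl
  src_bot := rfl
  tgt_bot := rfl
  top_app b := by simp
  bot_app b := by simp
  left_app b := by simp [VerTrans.id]
  right_app b := by simp [VerTrans.id]
  onHor := (hid x.transpose).onVer
  onVer := (hid x.transpose).onHor

/-- Horizontal composition of modifications. -/
def hcomp (m n : Modification B C) (h : m.right = n.left) : Modification B C where
  top := m.top.comp n.top (by rw [m.tgt_top, h, n.src_top])
  bot := m.bot.comp n.bot (by rw [m.tgt_bot, h, n.src_bot])
  left := m.left
  right := n.right
  app b := C.sqHcomp (m.app b) (n.app b)
  src_top := m.src_top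
  tgt_top := n.tgt_top
  src_bot := m.src_bot
  tgt_bot := n.tgt_bot
  top_app b := by simp only [HorTrans.comp]; grind
  bot_app b := by simp only [HorTrans.comp]; grind
  left_app b := by grind
  right_app b := by grind
  onHor f := by
    simp only [HorTrans.comp]
    have hm := m.onHor f
    have hn := n.onHor f
    have e₁ := C.sqVcomp_assoc (C.sqHcomp (C.sqVid (m.top.app (B.hsrc f))) (n.top.onHor f))
      (C.sqHcomp (m.top.onHor f) (C.sqVid (n.top.app (B.htgt f))))
      (C.sqHcomp (m.left.onHor f) (C.sqHcomp (m.app (B.htgt f)) (n.app (B.htgt f))))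
      (by grind) (by grind)
    have e₂ := C.sqHcomp_assoc (m.left.onHor f) (m.app (B.htgt f)) (n.app (B.htgt f))
      (by grind) (by grind)
    have e₃ := C.interchange (m.top.onHor f) (C.sqVid (n.top.app (B.htgt f)))
      (C.sqHcomp (m.left.onHor f) (m.app (B.htgt f))) (n.app (B.htgt f))
      (by grind) (by grind) (by grind) (by grind)
    have e₄ := C.interchange (C.sqHcomp (m.app (B.hsrc f)) (m.right.onHor f)) (n.app (B.htgt f))
      (m.bot.onHor f) (C.sqVid (n.bot.app (B.htgt f)))
      (by grind) (by grind) (by grind) (by grind)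
    have e₅ := C.sqHcomp_assoc (m.app (B.hsrc f)) (m.right.onHor f) (n.app (B.htgt f))
      (by grind) (by grind)
    have e₆ := C.sqVcomp_assoc (C.sqHcomp (C.sqVid (m.top.app (B.hsrc f))) (n.top.onHor f))
      (C.sqHcomp (m.app (B.hsrc f)) (C.sqHcomp (m.right.onHor f) (n.app (B.htgt f))))
      (C.sqHcomp (m.bot.onHor f) (C.sqVid (n.bot.app (B.htgt f))))
      (by grind) (by grind)
    have e₇ := C.interchange (C.sqVid (m.top.app (B.hsrc f))) (n.top.onHor f)
      (m.app (B.hsrc f)) (C.sqHcomp (m.right.onHor f) (n.app (B.htgt f)))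
      (by grind) (by grind) (by grind) (by grind)
    have e₈ := C.interchange (m.app (B.hsrc f)) (C.sqHcomp (n.app (B.hsrc f)) (n.right.onHor f))
      (C.sqVid (m.bot.app (B.hsrc f))) (n.bot.onHor f)
      (by grind) (by grind) (by grind) (by grind)
    have e₉ := C.sqHcomp_assoc (m.app (B.hsrc f)) (n.app (B.hsrc f)) (n.right.onHor f)
      (by grind) (by grind)
    have e₁₀ := C.sqVcomp_assoc
      (C.sqHcomp (m.app (B.hsrc f)) (C.sqHcomp (n.app (B.hsrc f)) (n.right.onHor f)))
      (C.sqHcomp (C.sqVid (m.bot.app (B.hsrc f))) (n.bot.onHor f))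
      (C.sqHcomp (m.bot.onHor f) (C.sqVid (n.bot.app (B.htgt f))))
      (by grind) (by grind)
    grind
  onVer s := by
    simp only [HorTrans.comp]
    have hm := m.onVer s
    have hn := n.onVer s
    have e₁ := C.interchange (m.top.onVer s) (n.top.onVer s) (m.app (B.vtgt s)) (n.app (B.vtgt s))
      (by grind) (by grind) (by grind) (by grind)
    have e₂ := C.interchange (m.app (B.vsrc s)) (n.app (B.vsrc s)) (m.bot.onVer s) (n.bot.onVer s)
      (by grind) (by grind) (by grind) (by grind)
    have e₃ := C.sqHcomp_assoc (m.left.onVer s)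
      (C.sqVcomp (m.top.onVer s) (m.app (B.vtgt s)))
      (C.sqVcomp (n.top.onVer s) (n.app (B.vtgt s))) (by grind) (by grind)
    have e₄ := C.sqHcomp_assoc (C.sqVcomp (m.app (B.vsrc s)) (m.bot.onVer s))
      (m.right.onVer s)
      (C.sqVcomp (n.top.onVer s) (n.app (B.vtgt s))) (by grind) (by grind)
    have e₅ := C.sqHcomp_assoc (C.sqVcomp (m.app (B.vsrc s)) (m.bot.onVer s))
      (C.sqVcomp (n.app (B.vsrc s)) (n.bot.onVer s)) (n.right.onVer s) (by grind) (by grind)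
    grind

/-- The horizontal composite of the transposes; used only for the proofs in `vcomp`. -/
abbrev vcompT (m n : Modification B C) (h : m.bot = n.top) :
    Modification B.transpose C.transpose :=
  m.transpose.hcomp n.transpose (congrArg HorTrans.transpose h)

/-- Vertical composition of modifications. -/
def vcomp (m n : Modification B C) (h : m.bot = n.top) : Modification B C where
  top := m.top
  bot := n.bot
  left := m.left.comp n.left (by rw [← m.src_bot, h, n.src_top])
  right := m.right.comp n.right (by rw [← m.tgt_bot, h, n.tgt_top])
  app b := C.sqVcomp (m.app b) (n.app b)
  src_top := m.src_top
  tgt_top := m.tgt_top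
  src_bot := n.src_bot
  tgt_bot := n.tgt_bot
  top_app b := by grind
  bot_app b := by grind
  left_app b := by simp only [VerTrans.comp]; grind
  right_app b := by simp only [VerTrans.comp]; grind
  onHor := (vcompT m n h).onVer
  onVer := (vcompT m n h).onHor

end Modification

/-- The internal hom `⟦B, C⟧`: double functors, horizontal pseudotransformations, vertical
pseudotransformations and modifications. -/
def DoubleCat.hom (B : DoubleCat.{u}) (C : DoubleCat.{v}) : DoubleCat.{max u v} where
  Obj := DoubleFunctor B C
  Hor := HorTrans B C
  Ver := VerTrans B C
  Sq := Modification B C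
  hsrc := HorTrans.src
  htgt := HorTrans.tgt
  vsrc := VerTrans.src
  vtgt := VerTrans.tgt
  top := Modification.top
  bot := Modification.bot
  left := Modification.left
  right := Modification.right
  hsrc_top := Modification.src_top
  htgt_top := Modification.tgt_top
  hsrc_bot := Modification.src_bot
  htgt_bot := Modification.tgt_bot
  hid := HorTrans.id
  hsrc_hid _ := rfl
  htgt_hid _ := rfl
  hcomp := HorTrans.comp
  hsrc_hcomp _ _ _ := rfl
  htgt_hcomp _ _ _ := rfl
  hid_hcomp := HorTrans.id_comp
  hcomp_hid := HorTrans.comp_id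
  hcomp_assoc := HorTrans.comp_assoc
  vid := VerTrans.id
  vsrc_vid _ := rfl
  vtgt_vid _ := rfl
  vcomp := VerTrans.comp
  vsrc_vcomp _ _ _ := rfl
  vtgt_vcomp _ _ _ := rfl
  vid_vcomp := VerTrans.id_comp
  vcomp_vid := VerTrans.comp_id
  vcomp_assoc := VerTrans.comp_assoc
  sqHid := Modification.hid
  top_sqHid _ := rfl
  bot_sqHid _ := rfl
  left_sqHid _ := rfl
  right_sqHid _ := rfl
  sqHcomp := Modification.hcomp
  top_sqHcomp _ _ _ := rfl
  bot_sqHcomp _ _ _ := rfl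
  left_sqHcomp _ _ _ := rfl
  right_sqHcomp _ _ _ := rfl
  sqHid_sqHcomp m := by
    have h₁ := HorTrans.id_comp m.top
    have h₂ := HorTrans.id_comp m.bot
    have h₃ := m.src_top
    have h₄ := m.src_bot
    ext1
    · simp only [Modification.hcomp, Modification.hid]; grind
    · simp only [Modification.hcomp, Modification.hid]; grind
    · rfl
    · rfl
    · funext b
      have := C.sqHid_sqHcomp (m.app b)
      simp only [Modification.hcomp, Modification.hid]; grind
  sqHcomp_sqHid m := by
    have h₁ := HorTrans.comp_id m.top
    have h₂ := HorTrans.comp_id m.bot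
    have h₃ := m.tgt_top
    have h₄ := m.tgt_bot
    ext1
    · simp only [Modification.hcomp, Modification.hid]; grind
    · simp only [Modification.hcomp, Modification.hid]; grind
    · rfl
    · rfl
    · funext b
      have := C.sqHcomp_sqHid (m.app b)
      simp only [Modification.hcomp, Modification.hid]; grind
  sqHcomp_assoc m n k h h' := by
    ext1
    · exact HorTrans.comp_assoc _ _ _ (by rw [m.tgt_top, h, n.src_top])
        (by rw [n.tgt_top, h', k.src_top])
    · exact HorTrans.comp_assoc _ _ _ (by rw [m.tgt_bot, h, n.src_bot])
        (by rw [n.tgt_bot, h', k.src_bot])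
    · rfl
    · rfl
    · funext b; exact C.sqHcomp_assoc _ _ _ (by grind) (by grind)
  sqVid := Modification.vid
  left_sqVid _ := rfl
  right_sqVid _ := rfl
  top_sqVid _ := rfl
  bot_sqVid _ := rfl
  sqVcomp := Modification.vcomp
  left_sqVcomp _ _ _ := rfl
  right_sqVcomp _ _ _ := rfl
  top_sqVcomp _ _ _ := rfl
  bot_sqVcomp _ _ _ := rfl
  sqVid_sqVcomp m := by
    have h₁ := VerTrans.id_comp m.left
    have h₂ := VerTrans.id_comp m.right
    have h₃ := m.src_top
    have h₄ := m.tgt_top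
    ext1
    · rfl
    · rfl
    · simp only [Modification.vcomp, Modification.vid]; grind
    · simp only [Modification.vcomp, Modification.vid]; grind
    · funext b
      have := C.sqVid_sqVcomp (m.app b)
      simp only [Modification.vcomp, Modification.vid]; grind
  sqVcomp_sqVid m := by
    have h₁ := VerTrans.comp_id m.left
    have h₂ := VerTrans.comp_id m.right
    have h₃ := m.src_bot
    have h₄ := m.tgt_bot
    ext1
    · rfl
    · rfl
    · simp only [Modification.vcomp, Modification.vid]; grind
    · simp only [Modification.vcomp, Modification.vid]; grind
    · funext b
      have := C.sqVcomp_sqVid (m.app b)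
      simp only [Modification.vcomp, Modification.vid]; grind
  sqVcomp_assoc m n k h h' := by
    ext1
    · rfl
    · rfl
    · exact VerTrans.comp_assoc _ _ _ (by rw [← m.src_bot, h, n.src_top])
        (by rw [← n.src_bot, h', k.src_top])
    · exact VerTrans.comp_assoc _ _ _ (by rw [← m.tgt_bot, h, n.tgt_top])
        (by rw [← n.tgt_bot, h', k.tgt_top])
    · funext b; exact C.sqVcomp_assoc _ _ _ (by grind) (by grind)
  sqHid_vid_eq F := by
    ext1
    · rfl
    · rfl
    · rfl
    · rfl
    · funext b; exact C.sqHid_vid_eq _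
  sqHid_vcomp p q h := by
    ext1
    · rfl
    · rfl
    · rfl
    · rfl
    · funext b; exact C.sqHid_vcomp _ _ (by grind)
  sqVid_hcomp x y h := by
    ext1
    · rfl
    · rfl
    · rfl
    · rfl
    · funext b; exact C.sqVid_hcomp _ _ (by grind)
  interchange m n k l h₁ h₂ h₃ h₄ := by
    ext1
    · rfl
    · rfl
    · rfl
    · rfl
    · funext b; exact C.interchange _ _ _ _ (by grind) (by grind) (by grind) (by grind)

/-- A cubical double functor from `A` and `B` to `C`. For objects `a` of `A` and `b` of `B`, `fst a` is
the double functor `(-, a) : B ⟶ C` and `snd b` is the double functor `(b, -) : A ⟶ C`. The letters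
`f`, `F` denote horizontal and `u`, `U` vertical 1-cells, of `B` and of `A` respectively; `ω` is a
square of `B` and `ζ` a square of `A`. -/
@[ext]
structure CubicalDoubleFunctor (A : DoubleCat.{u}) (B : DoubleCat.{v}) (C : DoubleCat.{w}) where
  fst : A.Obj → DoubleFunctor B C
  snd : B.Obj → DoubleFunctor A C
  agree : ∀ a b, (fst a).obj b = (snd b).obj a
  /-- the globular squares `(f, F)` -/
  hh : B.Hor → A.Hor → C.Sq
  /-- the squares `(u, F)` -/
  vh : B.Ver → A.Hor → C.Sq
  /-- the squares `(f, U)` -/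
  hv : B.Hor → A.Ver → C.Sq
  /-- the globular squares `(u, U)` -/
  vv : B.Ver → A.Ver → C.Sq
  top_hh : ∀ f F, C.top (hh f F) =
    C.hcomp ((snd (B.hsrc f)).hor F) ((fst (A.htgt F)).hor f)
  bot_hh : ∀ f F, C.bot (hh f F) =
    C.hcomp ((fst (A.hsrc F)).hor f) ((snd (B.htgt f)).hor F)
  left_hh : ∀ f F, C.left (hh f F) = C.vid ((fst (A.hsrc F)).obj (B.hsrc f))
  right_hh : ∀ f F, C.right (hh f F) = C.vid ((fst (A.htgt F)).obj (B.htgt f))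
  top_vh : ∀ u F, C.top (vh u F) = (snd (B.vsrc u)).hor F
  bot_vh : ∀ u F, C.bot (vh u F) = (snd (B.vtgt u)).hor F
  left_vh : ∀ u F, C.left (vh u F) = (fst (A.hsrc F)).ver u
  right_vh : ∀ u F, C.right (vh u F) = (fst (A.htgt F)).ver u
  top_hv : ∀ f U, C.top (hv f U) = (fst (A.vsrc U)).hor f
  bot_hv : ∀ f U, C.bot (hv f U) = (fst (A.vtgt U)).hor f
  left_hv : ∀ f U, C.left (hv f U) = (snd (B.hsrc f)).ver U
  right_hv : ∀ f U, C.right (hv f U) = (snd (B.htgt f)).ver U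
  top_vv : ∀ u U, C.top (vv u U) = C.hid ((fst (A.vsrc U)).obj (B.vsrc u))
  bot_vv : ∀ u U, C.bot (vv u U) = C.hid ((fst (A.vtgt U)).obj (B.vtgt u))
  left_vv : ∀ u U, C.left (vv u U) =
    C.vcomp ((snd (B.vsrc u)).ver U) ((fst (A.vtgt U)).ver u)
  right_vv : ∀ u U, C.right (vv u U) =
    C.vcomp ((fst (A.vsrc U)).ver u) ((snd (B.vtgt u)).ver U)
  hh_invertible : ∀ f F, C.VInvertible (hh f F)
  vv_invertible : ∀ u U, C.HInvertible (vv u U)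
  /- unit axioms -/
  hh_hid_left : ∀ b F, hh (B.hid b) F = C.sqVid ((snd b).hor F)
  hh_hid_right : ∀ f a, hh f (A.hid a) = C.sqVid ((fst a).hor f)
  vh_vid : ∀ b F, vh (B.vid b) F = C.sqVid ((snd b).hor F)
  vh_hid : ∀ u a, vh u (A.hid a) = C.sqHid ((fst a).ver u)
  hv_hid : ∀ b U, hv (B.hid b) U = C.sqHid ((snd b).ver U)
  hv_vid : ∀ f a, hv f (A.vid a) = C.sqVid ((fst a).hor f)
  vv_vid_left : ∀ b U, vv (B.vid b) U = C.sqHid ((snd b).ver U)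
  vv_vid_right : ∀ u a, vv u (A.vid a) = C.sqHid ((fst a).ver u)
  /- composition axioms -/
  hh_hcomp_left : ∀ f f' F (_ : B.htgt f = B.hsrc f'), hh (B.hcomp f f') F =
    C.sqVcomp (C.sqHcomp (hh f F) (C.sqVid ((fst (A.htgt F)).hor f')))
      (C.sqHcomp (C.sqVid ((fst (A.hsrc F)).hor f)) (hh f' F))
  hh_hcomp_right : ∀ f F F' (_ : A.htgt F = A.hsrc F'), hh f (A.hcomp F F') =
    C.sqVcomp (C.sqHcomp (C.sqVid ((snd (B.hsrc f)).hor F)) (hh f F'))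
      (C.sqHcomp (hh f F) (C.sqVid ((snd (B.htgt f)).hor F')))
  vh_vcomp : ∀ u u' F (_ : B.vtgt u = B.vsrc u'),
    vh (B.vcomp u u') F = C.sqVcomp (vh u F) (vh u' F)
  vh_hcomp : ∀ u F F' (_ : A.htgt F = A.hsrc F'),
    vh u (A.hcomp F F') = C.sqHcomp (vh u F) (vh u F')
  hv_hcomp : ∀ f f' U (_ : B.htgt f = B.hsrc f'),
    hv (B.hcomp f f') U = C.sqHcomp (hv f U) (hv f' U)
  hv_vcomp : ∀ f U U' (_ : A.vtgt U = A.vsrc U'),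
    hv f (A.vcomp U U') = C.sqVcomp (hv f U) (hv f U')
  vv_vcomp_right : ∀ u U U' (_ : A.vtgt U = A.vsrc U'), vv u (A.vcomp U U') =
    C.sqHcomp (C.sqVcomp (C.sqHid ((snd (B.vsrc u)).ver U)) (vv u U'))
      (C.sqVcomp (vv u U) (C.sqHid ((snd (B.vtgt u)).ver U')))
  vv_vcomp_left : ∀ u u' U (_ : B.vtgt u = B.vsrc u'), vv (B.vcomp u u') U =
    C.sqHcomp (C.sqVcomp (vv u U) (C.sqHid ((fst (A.vtgt U)).ver u')))
      (C.sqVcomp (C.sqHid ((fst (A.vsrc U)).ver u)) (vv u' U))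
  /- naturality axioms -/
  hh_vh : ∀ (ω : B.Sq) F,
    C.sqVcomp (hh (B.top ω) F) (C.sqHcomp ((fst (A.hsrc F)).sq ω) (vh (B.right ω) F)) =
      C.sqVcomp (C.sqHcomp (vh (B.left ω) F) ((fst (A.htgt F)).sq ω)) (hh (B.bot ω) F)
  hh_hv : ∀ f (ζ : A.Sq),
    C.sqVcomp (hh f (A.top ζ)) (C.sqHcomp (hv f (A.left ζ)) ((snd (B.htgt f)).sq ζ)) =
      C.sqVcomp (C.sqHcomp ((snd (B.hsrc f)).sq ζ) (hv f (A.right ζ))) (hh f (A.bot ζ))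
  vv_hv : ∀ (ω : B.Sq) U,
    C.sqHcomp (vv (B.left ω) U) (C.sqVcomp ((fst (A.vsrc U)).sq ω) (hv (B.bot ω) U)) =
      C.sqHcomp (C.sqVcomp (hv (B.top ω) U) ((fst (A.vtgt U)).sq ω)) (vv (B.right ω) U)
  vv_vh : ∀ u (ζ : A.Sq),
    C.sqHcomp (vv u (A.left ζ)) (C.sqVcomp (vh u (A.top ζ)) ((snd (B.vtgt u)).sq ζ)) =
      C.sqHcomp (C.sqVcomp ((snd (B.vsrc u)).sq ζ) (vh u (A.bot ζ))) (vv u (A.right ζ))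

/-! The two structures hold the same data and the same equations, sorted differently. A double
functor `Φ` into `⟦B, C⟧` assigns to each cell of `A` a structure whose components are indexed by
the cells of `B`. Regarding each component as a function of a pair of cells, one from `B` and one
from `A`, gives the families of a cubical double functor, and the axioms correspond as follows.

That `Φ.hor F` and `Φ.ver U` are pseudotransformations accounts for the unit and composition axioms
in the `B`-variable, for naturality in `ω`, and for invertibility of the squares `(f, F)` and `(u,
U)`. That `Φ.sq ζ` is a modification gives naturality in `ζ`. That `Φ` preserves identities and
composites of 1-cells gives the unit and composition axioms in the `A`-variable, because the squares
of an identity or composite pseudotransformation in `⟦B, C⟧` are defined by the pastings that those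
axioms prescribe. Preservation of squares and of their composites is a componentwise statement:
together with the object components of the 1-cells, it says that every `(b, -)` is a double functor.

No pasting calculation in `C` is left at this point, since those are needed only to show that `⟦B,
C⟧` is a double category. What remains is bookkeeping of boundaries. On one side, `Φ` preserves
sources and targets only up to propositional equality. On the other, a cubical double functor
records the object `(b, a)` twice, in `fst` and in `snd`, with `agree` relating the two. The lemmas
that carry the passage back to double functors are `horTrans_hcomp` and `verTrans_vcomp`, with their
unit versions. -/

namespace CubicalDoubleFunctor

variable {A : DoubleCat.{u}} {B : DoubleCat.{v}} {C : DoubleCat.{w}}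

/-! ### Components of a double functor into the internal hom -/

section Uncurry

variable (Φ : DoubleFunctor A (DoubleCat.hom B C))

/-- The double functor `(b, -)` of the components at `b` of a double functor `Φ : A ⟶ ⟦B, C⟧`. -/
def evalAt (b : B.Obj) : DoubleFunctor A C where
  obj a := DoubleFunctor.obj (Φ.obj a) b
  hor F := HorTrans.app (Φ.hor F) b
  ver U := VerTrans.app (Φ.ver U) b
  sq ζ := Modification.app (Φ.sq ζ) b
  -- For the boundaries two equations are chained: the component at `b` has the boundary dictated by
  -- the transformation or modification it belongs to, and `Φ` identifies that boundary with the
  -- image of the boundary in `A`.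
  hsrc_hor F := (HorTrans.hsrc_app (Φ.hor F) b).trans
    (congrArg (fun S : DoubleFunctor B C => S.obj b) (Φ.hsrc_hor F))
  htgt_hor F := (HorTrans.htgt_app (Φ.hor F) b).trans
    (congrArg (fun S : DoubleFunctor B C => S.obj b) (Φ.htgt_hor F))
  vsrc_ver U := (VerTrans.vsrc_app (Φ.ver U) b).trans
    (congrArg (fun S : DoubleFunctor B C => S.obj b) (Φ.vsrc_ver U))
  vtgt_ver U := (VerTrans.vtgt_app (Φ.ver U) b).trans
    (congrArg (fun S : DoubleFunctor B C => S.obj b) (Φ.vtgt_ver U))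
  top_sq ζ := (Modification.top_app (Φ.sq ζ) b).trans
    (congrArg (fun x : HorTrans B C => x.app b) (Φ.top_sq ζ))
  bot_sq ζ := (Modification.bot_app (Φ.sq ζ) b).trans
    (congrArg (fun x : HorTrans B C => x.app b) (Φ.bot_sq ζ))
  left_sq ζ := (Modification.left_app (Φ.sq ζ) b).trans
    (congrArg (fun p : VerTrans B C => p.app b) (Φ.left_sq ζ))
  right_sq ζ := (Modification.right_app (Φ.sq ζ) b).trans
    (congrArg (fun p : VerTrans B C => p.app b) (Φ.right_sq ζ))
  -- Identities and composites in `⟦B, C⟧` are componentwise by definition, so each remaining law is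
  -- the corresponding law of `Φ` read at `b`.
  hor_hid a := congrArg (fun x : HorTrans B C => x.app b) (Φ.hor_hid a)
  hor_hcomp F G h := congrArg (fun x : HorTrans B C => x.app b) (Φ.hor_hcomp F G h)
  ver_vid a := congrArg (fun p : VerTrans B C => p.app b) (Φ.ver_vid a)
  ver_vcomp U V h := congrArg (fun p : VerTrans B C => p.app b) (Φ.ver_vcomp U V h)
  sq_sqHid U := congrArg (fun m : Modification B C => m.app b) (Φ.sq_sqHid U)
  sq_sqHcomp α β h := congrArg (fun m : Modification B C => m.app b) (Φ.sq_sqHcomp α β h)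
  sq_sqVid F := congrArg (fun m : Modification B C => m.app b) (Φ.sq_sqVid F)
  sq_sqVcomp α β h := congrArg (fun m : Modification B C => m.app b) (Φ.sq_sqVcomp α β h)

/-- The cubical double functor of the components of a double functor `Φ : A ⟶ ⟦B, C⟧`. -/
def ofDoubleFunctor : CubicalDoubleFunctor A B C where
  fst a := Φ.obj a
  snd b := evalAt Φ b
  agree _ _ := rfl
  hh f F := HorTrans.onHor (Φ.hor F) f
  vh s F := HorTrans.onVer (Φ.hor F) s
  hv f U := VerTrans.onHor (Φ.ver U) f
  vv s U := VerTrans.onVer (Φ.ver U) s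
  -- The law of `Φ.hor F` speaks of that transformation's own source and target, while the goal
  -- speaks of `Φ` at the endpoints of `F`. The goal is therefore rewritten backwards along the
  -- boundary equations of `Φ`. Fields that involve only components of the transformation need no
  -- such rewriting.
  top_hh f F := by
    simp only [← Φ.htgt_hor F]; exact HorTrans.top_onHor (Φ.hor F) f
  bot_hh f F := by
    simp only [← Φ.hsrc_hor F]; exact HorTrans.bot_onHor (Φ.hor F) f
  left_hh f F := by
    simp only [← Φ.hsrc_hor F]; exact HorTrans.left_onHor (Φ.hor F) f
  right_hh f F := by
    simp only [← Φ.htgt_hor F]; exact HorTrans.right_onHor (Φ.hor F) f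
  top_vh s F := HorTrans.top_onVer (Φ.hor F) s
  bot_vh s F := HorTrans.bot_onVer (Φ.hor F) s
  left_vh s F := by
    simp only [← Φ.hsrc_hor F]; exact HorTrans.left_onVer (Φ.hor F) s
  right_vh s F := by
    simp only [← Φ.htgt_hor F]; exact HorTrans.right_onVer (Φ.hor F) s
  top_hv f U := by
    simp only [← Φ.vsrc_ver U]; exact VerTrans.top_onHor (Φ.ver U) f
  bot_hv f U := by
    simp only [← Φ.vtgt_ver U]; exact VerTrans.bot_onHor (Φ.ver U) f
  left_hv f U := VerTrans.left_onHor (Φ.ver U) f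
  right_hv f U := VerTrans.right_onHor (Φ.ver U) f
  top_vv s U := by
    simp only [← Φ.vsrc_ver U]; exact VerTrans.top_onVer (Φ.ver U) s
  bot_vv s U := by
    simp only [← Φ.vtgt_ver U]; exact VerTrans.bot_onVer (Φ.ver U) s
  left_vv s U := by
    simp only [← Φ.vtgt_ver U]; exact VerTrans.left_onVer (Φ.ver U) s
  right_vv s U := by
    simp only [← Φ.vsrc_ver U]; exact VerTrans.right_onVer (Φ.ver U) s
  hh_invertible f F := HorTrans.invertible (Φ.hor F) f
  vv_invertible s U := VerTrans.invertible (Φ.ver U) s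
  hh_hid_left b F := HorTrans.onHor_hid (Φ.hor F) b
  hh_hid_right f a := congrArg (fun x : HorTrans B C => x.onHor f) (Φ.hor_hid a)
  vh_vid b F := HorTrans.onVer_vid (Φ.hor F) b
  vh_hid s a := congrArg (fun x : HorTrans B C => x.onVer s) (Φ.hor_hid a)
  hv_hid b U := VerTrans.onHor_hid (Φ.ver U) b
  hv_vid f a := congrArg (fun p : VerTrans B C => p.onHor f) (Φ.ver_vid a)
  vv_vid_left b U := VerTrans.onVer_vid (Φ.ver U) b
  vv_vid_right s a := congrArg (fun p : VerTrans B C => p.onVer s) (Φ.ver_vid a)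
  hh_hcomp_left f f' F h := by
    simp only [← Φ.htgt_hor F, ← Φ.hsrc_hor F]
    exact HorTrans.onHor_hcomp (Φ.hor F) f f' h
  -- The `f`-square of `HorTrans.comp` is by definition the required pasting, with the square of the
  -- second factor on top.
  hh_hcomp_right f F F' h := congrArg (fun x : HorTrans B C => x.onHor f) (Φ.hor_hcomp F F' h)
  vh_vcomp s s' F h := HorTrans.onVer_vcomp (Φ.hor F) s s' h
  vh_hcomp s F F' h := congrArg (fun x : HorTrans B C => x.onVer s) (Φ.hor_hcomp F F' h)
  hv_hcomp f f' U h := VerTrans.onHor_hcomp (Φ.ver U) f f' h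
  hv_vcomp f U U' h := congrArg (fun p : VerTrans B C => p.onHor f) (Φ.ver_vcomp U U' h)
  vv_vcomp_right s U U' h := congrArg (fun p : VerTrans B C => p.onVer s) (Φ.ver_vcomp U U' h)
  vv_vcomp_left s s' U h := by
    simp only [← Φ.vtgt_ver U, ← Φ.vsrc_ver U]
    exact VerTrans.onVer_vcomp (Φ.ver U) s s' h
  hh_vh ω F := by
    simp only [← Φ.htgt_hor F, ← Φ.hsrc_hor F]
    exact HorTrans.naturality (Φ.hor F) ω
  -- The modification law is stated for the four boundary transformations stored in `Φ.sq ζ`, which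
  -- have to be identified with the images under `Φ` of the four sides of `ζ`.
  hh_hv f ζ := by
    simp only [← Φ.top_sq ζ, ← Φ.bot_sq ζ, ← Φ.left_sq ζ, ← Φ.right_sq ζ]
    exact Modification.onHor (Φ.sq ζ) f
  vv_hv ω U := by
    simp only [← Φ.vtgt_ver U, ← Φ.vsrc_ver U]
    exact VerTrans.naturality (Φ.ver U) ω
  vv_vh s ζ := by
    simp only [← Φ.top_sq ζ, ← Φ.bot_sq ζ, ← Φ.left_sq ζ, ← Φ.right_sq ζ]
    exact Modification.onVer (Φ.sq ζ) s

end Uncurry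

/-! ### Pseudotransformations and modifications from a cubical double functor -/

section Curry

variable (P : CubicalDoubleFunctor A B C)

/-- The horizontal pseudotransformation `(-, F)` of a cubical double functor. -/
def horTrans (F : A.Hor) : HorTrans B C where
  src := P.fst (A.hsrc F)
  tgt := P.fst (A.htgt F)
  app b := (P.snd b).hor F
  onVer s := P.vh s F
  onHor f := P.hh f F
  -- The 1-cell `(b, F)` comes from `snd b`, but the transformation runs between double functors
  -- given by `fst`. Its endpoints match only through `agree`.
  hsrc_app b := by rw [DoubleFunctor.hsrc_hor, P.agree]
  htgt_app b := by rw [DoubleFunctor.htgt_hor, P.agree]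
  top_onVer s := P.top_vh s F
  bot_onVer s := P.bot_vh s F
  left_onVer s := P.left_vh s F
  right_onVer s := P.right_vh s F
  top_onHor f := P.top_hh f F
  bot_onHor f := P.bot_hh f F
  left_onHor f := P.left_hh f F
  right_onHor f := P.right_hh f F
  invertible f := P.hh_invertible f F
  onVer_vid b := P.vh_vid b F
  onVer_vcomp s t h := P.vh_vcomp s t F h
  onHor_hid b := P.hh_hid_left b F
  onHor_hcomp f g h := P.hh_hcomp_left f g F h
  naturality ω := P.hh_vh ω F

/-- The vertical pseudotransformation `(-, U)` of a cubical double functor. -/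
def verTrans (U : A.Ver) : VerTrans B C where
  src := P.fst (A.vsrc U)
  tgt := P.fst (A.vtgt U)
  app b := (P.snd b).ver U
  onHor f := P.hv f U
  onVer s := P.vv s U
  vsrc_app b := by rw [DoubleFunctor.vsrc_ver, P.agree]
  vtgt_app b := by rw [DoubleFunctor.vtgt_ver, P.agree]
  left_onHor f := P.left_hv f U
  right_onHor f := P.right_hv f U
  top_onHor f := P.top_hv f U
  bot_onHor f := P.bot_hv f U
  left_onVer s := P.left_vv s U
  right_onVer s := P.right_vv s U
  top_onVer s := P.top_vv s U
  bot_onVer s := P.bot_vv s U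
  invertible s := P.vv_invertible s U
  onHor_hid b := P.hv_hid b U
  onHor_hcomp f g h := P.hv_hcomp f g U h
  onVer_vid b := P.vv_vid_left b U
  onVer_vcomp s t h := P.vv_vcomp_left s t U h
  naturality ω := P.vv_hv ω U

/-- The modification `(-, ζ)` of a cubical double functor. -/
def modification (ζ : A.Sq) : Modification B C where
  top := P.horTrans (A.top ζ)
  bot := P.horTrans (A.bot ζ)
  left := P.verTrans (A.left ζ)
  right := P.verTrans (A.right ζ)
  app b := (P.snd b).sq ζ
  -- Each compatibility condition concerns one corner of `ζ`, whose two descriptions are equal in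
  -- `A`.
  src_top := congrArg P.fst (A.hsrc_top ζ)
  tgt_top := congrArg P.fst (A.htgt_top ζ)
  src_bot := congrArg P.fst (A.hsrc_bot ζ)
  tgt_bot := congrArg P.fst (A.htgt_bot ζ)
  top_app b := (P.snd b).top_sq ζ
  bot_app b := (P.snd b).bot_sq ζ
  left_app b := (P.snd b).left_sq ζ
  right_app b := (P.snd b).right_sq ζ
  onHor f := P.hh_hv f ζ
  onVer s := P.vv_vh s ζ

/-! ### Functoriality in the variable `A` -/

theorem horTrans_hid (a : A.Obj) : P.horTrans (A.hid a) = HorTrans.id (P.fst a) :=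
  HorTrans.ext (congrArg P.fst (A.hsrc_hid a)) (congrArg P.fst (A.htgt_hid a))
    (funext fun b => ((P.snd b).hor_hid a).trans (congrArg C.hid (P.agree a b).symm))
    (funext fun s => P.vh_hid s a) (funext fun f => P.hh_hid_right f a)

/-- Equality of transformations is checked on data. On 1-cell components it is functoriality of `(b,
-)`; on squares it is the pair of axioms for `(u, F·F')` and `(f, F·F')`, whose right-hand sides are
the squares of `HorTrans.comp`. -/
theorem horTrans_hcomp (F G : A.Hor) (h : A.htgt F = A.hsrc G) :
    P.horTrans (A.hcomp F G) = (P.horTrans F).comp (P.horTrans G) (congrArg P.fst h) :=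
  HorTrans.ext (congrArg P.fst (A.hsrc_hcomp F G h)) (congrArg P.fst (A.htgt_hcomp F G h))
    (funext fun b => (P.snd b).hor_hcomp F G h)
    (funext fun s => P.vh_hcomp s F G h) (funext fun f => P.hh_hcomp_right f F G h)

theorem verTrans_vid (a : A.Obj) : P.verTrans (A.vid a) = VerTrans.id (P.fst a) :=
  VerTrans.ext (congrArg P.fst (A.vsrc_vid a)) (congrArg P.fst (A.vtgt_vid a))
    (funext fun b => ((P.snd b).ver_vid a).trans (congrArg C.vid (P.agree a b).symm))
    (funext fun f => P.hv_vid f a) (funext fun s => P.vv_vid_right s a)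

/-- The vertical counterpart, in which the axioms for `(f, U·U')` and `(u, U·U')` supply the squares
of `VerTrans.comp`. -/
theorem verTrans_vcomp (U V : A.Ver) (h : A.vtgt U = A.vsrc V) :
    P.verTrans (A.vcomp U V) = (P.verTrans U).comp (P.verTrans V) (congrArg P.fst h) :=
  VerTrans.ext (congrArg P.fst (A.vsrc_vcomp U V h)) (congrArg P.fst (A.vtgt_vcomp U V h))
    (funext fun b => (P.snd b).ver_vcomp U V h)
    (funext fun f => P.hv_vcomp f U V h) (funext fun s => P.vv_vcomp_right s U V h)

/-- The double functor `A ⟶ ⟦B, C⟧` of a cubical double functor. -/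
def toDoubleFunctor : DoubleFunctor A (DoubleCat.hom B C) where
  obj := P.fst
  hor := P.horTrans
  ver := P.verTrans
  sq := P.modification
  hsrc_hor _ := rfl
  htgt_hor _ := rfl
  vsrc_ver _ := rfl
  vtgt_ver _ := rfl
  top_sq _ := rfl
  bot_sq _ := rfl
  left_sq _ := rfl
  right_sq _ := rfl
  hor_hid := P.horTrans_hid
  hor_hcomp := P.horTrans_hcomp
  ver_vid := P.verTrans_vid
  ver_vcomp := P.verTrans_vcomp
  -- A modification stores its boundary as data, so every law for squares needs four boundary
  -- equations besides the equation of components. Two of them come from the boundary laws of `A`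
  -- alone; the other two also use that identities or composites of 1-cells are preserved.
  sq_sqHid U := Modification.ext
    ((congrArg P.horTrans (A.top_sqHid U)).trans (P.horTrans_hid _))
    ((congrArg P.horTrans (A.bot_sqHid U)).trans (P.horTrans_hid _))
    (congrArg P.verTrans (A.left_sqHid U)) (congrArg P.verTrans (A.right_sqHid U))
    (funext fun b => (P.snd b).sq_sqHid U)
  sq_sqHcomp α β h := Modification.ext
    ((congrArg P.horTrans (A.top_sqHcomp α β h)).trans
      (P.horTrans_hcomp _ _ (by grind)))
    ((congrArg P.horTrans (A.bot_sqHcomp α β h)).trans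
      (P.horTrans_hcomp _ _ (by grind)))
    (congrArg P.verTrans (A.left_sqHcomp α β h)) (congrArg P.verTrans (A.right_sqHcomp α β h))
    (funext fun b => (P.snd b).sq_sqHcomp α β h)
  sq_sqVid F := Modification.ext
    (congrArg P.horTrans (A.top_sqVid F)) (congrArg P.horTrans (A.bot_sqVid F))
    ((congrArg P.verTrans (A.left_sqVid F)).trans (P.verTrans_vid _))
    ((congrArg P.verTrans (A.right_sqVid F)).trans (P.verTrans_vid _))
    (funext fun b => (P.snd b).sq_sqVid F)
  sq_sqVcomp α β h := Modification.ext
    (congrArg P.horTrans (A.top_sqVcomp α β h)) (congrArg P.horTrans (A.bot_sqVcomp α β h))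
    ((congrArg P.verTrans (A.left_sqVcomp α β h)).trans
      -- The left sides are composable because they meet at the source of the common horizontal edge
      -- of `α` and `β`.
      (P.verTrans_vcomp _ _ (by rw [← A.hsrc_bot, h, A.hsrc_top])))
    ((congrArg P.verTrans (A.right_sqVcomp α β h)).trans
      (P.verTrans_vcomp _ _ (by rw [← A.htgt_bot, h, A.htgt_top])))
    (funext fun b => (P.snd b).sq_sqVcomp α β h)

end Curry

/-! ### The two constructions are mutually inverse -/

/-- All components return definitionally. Only the stored sources, targets and boundaries are
rebuilt from the cells of `A`, and the boundary laws of `Φ` show that they are unchanged. -/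
theorem toDoubleFunctor_ofDoubleFunctor (Φ : DoubleFunctor A (DoubleCat.hom B C)) :
    (ofDoubleFunctor Φ).toDoubleFunctor = Φ := by
  have hhor : ∀ F, (ofDoubleFunctor Φ).horTrans F = Φ.hor F := fun F =>
    HorTrans.ext (Φ.hsrc_hor F).symm (Φ.htgt_hor F).symm rfl rfl rfl
  have hver : ∀ U, (ofDoubleFunctor Φ).verTrans U = Φ.ver U := fun U =>
    VerTrans.ext (Φ.vsrc_ver U).symm (Φ.vtgt_ver U).symm rfl rfl rfl
  exact DoubleFunctor.ext rfl (funext hhor) (funext hver) (funext fun ζ => Modification.ext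
    ((hhor _).trans (Φ.top_sq ζ).symm) ((hhor _).trans (Φ.bot_sq ζ).symm)
    ((hver _).trans (Φ.left_sq ζ).symm) ((hver _).trans (Φ.right_sq ζ).symm) rfl)

/-- The only datum not recovered definitionally is the object map of `(b, -)`: it comes back as the
value of `fst a` at `b`, and `agree` equates this with the original. -/
theorem ofDoubleFunctor_toDoubleFunctor (P : CubicalDoubleFunctor A B C) :
    ofDoubleFunctor P.toDoubleFunctor = P :=
  CubicalDoubleFunctor.ext rfl
    (funext fun b => DoubleFunctor.ext (funext fun a => P.agree a b) rfl rfl rfl) rfl rfl rfl rfl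

/-- Double functors `A ⟶ ⟦B, C⟧` are the same as cubical double functors from `A` and `B` to `C`. -/
def equivDoubleFunctor :
    DoubleFunctor A (DoubleCat.hom B C) ≃ CubicalDoubleFunctor A B C where
  toFun := ofDoubleFunctor
  invFun := toDoubleFunctor
  left_inv := toDoubleFunctor_ofDoubleFunctor
  right_inv := ofDoubleFunctor_toDoubleFunctor

end CubicalDoubleFunctor

/-- Sending a double functor `Φ : A ⟶ ⟦B, C⟧` to its components is a bijection onto the cubical double
functors from `A` and `B` to `C`. -/
theorem mainTheorem8 (A : DoubleCat.{u}) (B : DoubleCat.{v}) (C : DoubleCat.{w}) :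
    ∃ e : DoubleFunctor A (DoubleCat.hom B C) ≃ CubicalDoubleFunctor A B C,
      ∀ Φ : DoubleFunctor A (DoubleCat.hom B C),
        (∀ a : A.Obj, (e Φ).fst a = Φ.obj a) ∧
        (∀ (b : B.Obj) (a : A.Obj), ((e Φ).snd b).obj a = DoubleFunctor.obj (Φ.obj a) b) ∧
        (∀ (b : B.Obj) (F : A.Hor), ((e Φ).snd b).hor F = HorTrans.app (Φ.hor F) b) ∧
        (∀ (b : B.Obj) (U : A.Ver), ((e Φ).snd b).ver U = VerTrans.app (Φ.ver U) b) ∧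
        (∀ (b : B.Obj) (ζ : A.Sq), ((e Φ).snd b).sq ζ = Modification.app (Φ.sq ζ) b) ∧
        (∀ (f : B.Hor) (F : A.Hor), (e Φ).hh f F = HorTrans.onHor (Φ.hor F) f) ∧
        (∀ (u : B.Ver) (F : A.Hor), (e Φ).vh u F = HorTrans.onVer (Φ.hor F) u) ∧
        (∀ (f : B.Hor) (U : A.Ver), (e Φ).hv f U = VerTrans.onHor (Φ.ver U) f) ∧
        (∀ (u : B.Ver) (U : A.Ver), (e Φ).vv u U = VerTrans.onVer (Φ.ver U) u) :=
  -- Every clause holds by definition of `ofDoubleFunctor`. Together the clauses fix all data of the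
  -- cubical double functor, so the bijection is determined by them.
  ⟨CubicalDoubleFunctor.equivDoubleFunctor, fun _ => ⟨fun _ => rfl, fun _ _ => rfl, fun _ _ => rfl,
    fun _ _ => rfl, fun _ _ => rfl, fun _ _ => rfl, fun _ _ => rfl, fun _ _ => rfl, fun _ _ => rfl⟩⟩
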